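/- A *tree-like tableau* is a Young diagram some of whose cells contain a point, such that: the top left cell contains a point (the root); every other point has either a point above it in its column or a point to its left in its row, but not both; and no row or column is empty of points. Its *size* is its number of points, and $\mathcal T_n$ denotes the set of tree-like tableaux of size $n$. The edges of the Southeast border (the border edges) of $T\in\mathcal T_n$ are numbered $e_1,\dots,e_{n+1}$ from Southwest to Northeast. The *special point* of $T$ is the right-most point among those lying in the bottom cell of a column, and $sp(T)$ is the index of the border edge under it. *Inserting a point* in $T$ at a horizontal (resp. vertical) border edge $e_i$ means: insert a row (resp. column) of empty cells just below (resp. to the right of) $e_i$, starting at the left (resp. top) border of $T$ and ending below (resp. to the right of) $e_i$; put a point in its right-most (resp. bottom) cell; and, if $i<sp(T)$, add along the border the ribbon of empty cells that goes from the cell to the right of the new point to the cell under the special point of $T$. Every $T\in\mathcal T_n$ is obtained from the tableau of size $1$ by a unique sequence of $n-1$ insertions; for $2\le k\le n$ let $p_k(T)$ be the point added by the $(k-1)$-th one. A *corner* of $T$ is a cell whose bottom and right edges are both border edges, and $oc(\mathcal T_n)$ is the sum over $T\in\mathcal T_n$ of the number of corners of $T$ that contain a point. **Proposition.** Let $n\ge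 1$. Every $T\in\mathcal T_n$ is obtained by a unique sequence of insertions as above, so that the points $p_k(T)$ are well defined. For $2\le k\le n$, the number of $T\in\mathcal T_n$ such that $p_k(T)$ lies in a corner of $T$ is $$\frac{n!}{(n-k+2)(n-k+1)}+\begin{cases}(n-1)! & \text{if } k=n,\\ 0 & \text{otherwise.}\end{cases}$$ Moreover, if $n\ge 2$, the sum of these numbers over $k=2,\dots,n$ equals $oc(\mathcal T_n)$; and $oc(\mathcal T_n)=n!$ for all $n\ge 1$. -/

import Mathlib

namespace TreeLike

/-- A filling of a Young diagram with points: some of the cells carry a point.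
Cells are pairs (row, column), counted from `0`, the top left cell being `(0, 0)`. -/
@[ext] structure Filling where
  /-- The underlying Young diagram. -/
  shape : YoungDiagram
  /-- The cells that contain a point. -/
  points : Finset (ℕ × ℕ)
  /-- Points lie in cells of the diagram. -/
  points_subset : points ⊆ shape.cells

/-- The three rules of a tree-like tableau. -/
structure Filling.IsTreeLike (T : Filling) : Prop where
  /-- The top left cell has a point. -/
  root : (0, 0) ∈ T.points
  /-- A non-root point has a point above it in its column or to its left in its row, not both. -/
  parent : ∀ p ∈ T.points, p ≠ (0, 0) →
    Xor (∃ q ∈ T.points, q.2 = p.2 ∧ q.1 < p.1) (∃ q ∈ T.points, q.1 = p.1 ∧ q.2 < p.2)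
  /-- There is no empty row. -/
  row : ∀ r < T.shape.colLen 0, ∃ p ∈ T.points, p.1 = r
  /-- There is no empty column. -/
  col : ∀ c < T.shape.rowLen 0, ∃ p ∈ T.points, p.2 = c

/-- The set of tree-like tableaux of size `n`, i.e. with `n` points. -/
def tableaux (n : ℕ) : Set Filling := {T | T.IsTreeLike ∧ T.points.card = n}

/-- A corner: a cell whose bottom and right edges both lie on the border of the diagram. -/
def IsCorner (μ : YoungDiagram) (p : ℕ × ℕ) : Prop :=
  p ∈ μ ∧ (p.1 + 1, p.2) ∉ μ ∧ (p.1, p.2 + 1) ∉ μ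

instance (μ : YoungDiagram) (p : ℕ × ℕ) : Decidable (IsCorner μ p) := by
  unfold IsCorner; infer_instance

/-- The number of occupied corners of a filling. -/
def oc (T : Filling) : ℕ := (T.points.filter (IsCorner T.shape)).card

/-- The number of occupied corners in a set of fillings. -/
noncomputable def ocSet (X : Set Filling) : ℕ := ∑ᶠ T ∈ X, oc T

/-- Edges of the Southeast border: the bottom edge of the last cell of a column (horizontal),
or the right edge of the last cell of a row (vertical). -/
inductive Edge where
  | below (col : ℕ)
  | right (row : ℕ)

/-- The column, resp. the row, of the edge is one of the diagram. -/
def Edge.IsBorder (μ : YoungDiagram) : Edge → Prop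
  | .below c => c < μ.rowLen 0
  | .right r => r < μ.colLen 0

/-- The index of a border edge: the border edges are numbered `1, 2, 3, …` along the Southeast
border, from its Southwest end to its Northeast end. Thus the index is one more than the number
of columns strictly to the left plus the number of rows strictly below that have been passed. -/
def Edge.index (μ : YoungDiagram) : Edge → ℕ
  | .below c => 1 + c + (μ.colLen 0 - μ.colLen c)
  | .right r => 1 + μ.rowLen r + (μ.colLen 0 - (r + 1))

/-- The cell of the new point when inserting at an edge. -/
def newCell (μ : YoungDiagram) : Edge → ℕ × ℕ
  | .below c => (μ.colLen c, c)
  | .right r => (r, μ.rowLen r)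

/-- Where a cell of the old diagram goes when a row, resp. a column, is inserted at an edge. -/
def shift (μ : YoungDiagram) : Edge → ℕ × ℕ → ℕ × ℕ
  | .below c, p => (if p.1 < μ.colLen c then p.1 else p.1 + 1, p.2)
  | .right r, p => (p.1, if p.2 < μ.rowLen r then p.2 else p.2 + 1)

/-- The cells of the inserted row, resp. column. -/
def newLine (μ : YoungDiagram) : Edge → Finset (ℕ × ℕ)
  | .below c => (Finset.range (c + 1)).image fun j => (μ.colLen c, j)
  | .right r => (Finset.range (r + 1)).image fun i => (i, μ.rowLen r)

theorem mem_insert_below (μ : YoungDiagram) (j x y : ℕ) :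
    (x, y) ∈ μ.cells.image (shift μ (.below j)) ∪ newLine μ (.below j) ↔
      (x < μ.colLen j ∧ (x, y) ∈ μ) ∨ (μ.colLen j < x ∧ (x - 1, y) ∈ μ) ∨
        (x = μ.colLen j ∧ y ≤ j) := by
  simp only [Finset.mem_union, Finset.mem_image, newLine, shift, Prod.exists, Prod.mk.injEq,
    YoungDiagram.mem_cells, Finset.mem_range]
  constructor
  · rintro (⟨a, b, hab, hx, rfl⟩ | ⟨a, ha, rfl, rfl⟩)
    · split_ifs at hx with h
      · subst hx; exact Or.inl ⟨h, hab⟩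
      · subst hx; exact Or.inr (Or.inl ⟨by omega, by simpa using hab⟩)
    · exact Or.inr (Or.inr ⟨rfl, by omega⟩)
  · rintro (⟨h, hm⟩ | ⟨h, hm⟩ | ⟨rfl, h⟩)
    · exact Or.inl ⟨x, y, hm, by simp [h], rfl⟩
    · refine Or.inl ⟨x - 1, y, hm, ?_, rfl⟩
      rw [if_neg (by omega)]; omega
    · exact Or.inr ⟨y, by omega, rfl, rfl⟩

theorem mem_insert_right (μ : YoungDiagram) (i x y : ℕ) :
    (x, y) ∈ μ.cells.image (shift μ (.right i)) ∪ newLine μ (.right i) ↔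
      (y < μ.rowLen i ∧ (x, y) ∈ μ) ∨ (μ.rowLen i < y ∧ (x, y - 1) ∈ μ) ∨
        (y = μ.rowLen i ∧ x ≤ i) := by
  simp only [Finset.mem_union, Finset.mem_image, newLine, shift, Prod.exists, Prod.mk.injEq,
    YoungDiagram.mem_cells, Finset.mem_range]
  constructor
  · rintro (⟨a, b, hab, rfl, hx⟩ | ⟨a, ha, rfl, rfl⟩)
    · split_ifs at hx with h
      · subst hx; exact Or.inl ⟨h, hab⟩
      · subst hx; exact Or.inr (Or.inl ⟨by omega, by simpa using hab⟩)
    · exact Or.inr (Or.inr ⟨rfl, by omega⟩)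
  · rintro (⟨h, hm⟩ | ⟨h, hm⟩ | ⟨rfl, h⟩)
    · exact Or.inl ⟨x, y, hm, rfl, by simp [h]⟩
    · refine Or.inl ⟨x, y - 1, hm, rfl, ?_⟩
      rw [if_neg (by omega)]; omega
    · exact Or.inr ⟨x, by omega, rfl, rfl⟩

/-- The diagram after insertion, at an edge, of a row from the left border to that edge,
resp. of a column from the top border to that edge. -/
def insertLine (μ : YoungDiagram) (e : Edge) : YoungDiagram where
  cells := μ.cells.image (shift μ e) ∪ newLine μ e
  isLowerSet := by
    rintro ⟨a, b⟩ ⟨c, d⟩ hle hab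
    obtain ⟨h1, h2⟩ : c ≤ a ∧ d ≤ b := hle
    cases e with
    | below j =>
      have hj : ∀ x, (x, j) ∈ μ ↔ x < μ.colLen j := fun x => YoungDiagram.mem_iff_lt_colLen
      simp only [Finset.mem_coe, mem_insert_below] at hab ⊢
      rcases hab with ⟨h, hm⟩ | ⟨h, hm⟩ | ⟨h, hm⟩
      · exact Or.inl ⟨by omega, μ.up_left_mem h1 h2 hm⟩
      · rcases lt_trichotomy c (μ.colLen j) with hc | hc | hc
        · exact Or.inl ⟨hc, μ.up_left_mem (by omega) h2 hm⟩
        · refine Or.inr (Or.inr ⟨hc, ?_⟩)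
          by_contra hd
          have := (hj _).1 (μ.up_left_mem le_rfl (by omega : j ≤ b) hm)
          omega
        · exact Or.inr (Or.inl ⟨hc, μ.up_left_mem (by omega) h2 hm⟩)
      · rcases lt_or_eq_of_le h1 with hc | hc
        · exact Or.inl ⟨by omega, μ.up_left_mem le_rfl (by omega) ((hj c).2 (by omega))⟩
        · exact Or.inr (Or.inr ⟨by omega, by omega⟩)
    | right i =>
      have hi : ∀ y, (i, y) ∈ μ ↔ y < μ.rowLen i := fun y => YoungDiagram.mem_iff_lt_rowLen
      simp only [Finset.mem_coe, mem_insert_right] at hab ⊢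
      rcases hab with ⟨h, hm⟩ | ⟨h, hm⟩ | ⟨h, hm⟩
      · exact Or.inl ⟨by omega, μ.up_left_mem h1 h2 hm⟩
      · rcases lt_trichotomy d (μ.rowLen i) with hc | hc | hc
        · exact Or.inl ⟨hc, μ.up_left_mem h1 (by omega) hm⟩
        · refine Or.inr (Or.inr ⟨hc, ?_⟩)
          by_contra hd
          have := (hi _).1 (μ.up_left_mem (by omega : i ≤ a) le_rfl hm)
          omega
        · exact Or.inr (Or.inl ⟨hc, μ.up_left_mem h1 (by omega) hm⟩)
      · rcases lt_or_eq_of_le h2 with hc | hc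
        · exact Or.inl ⟨by omega, μ.up_left_mem (by omega) le_rfl ((hi d).2 (by omega))⟩
        · exact Or.inr (Or.inr ⟨by omega, by omega⟩)

/-- The column of the special point, which is the right-most among the points that lie at the
bottom of a column. -/
def specialCol (T : Filling) : ℕ :=
  ((Finset.range (T.shape.rowLen 0)).filter
    fun c => (T.shape.colLen c - 1, c) ∈ T.points).sup id

/-- The special point. -/
def specialPoint (T : Filling) : ℕ × ℕ := (T.shape.colLen (specialCol T) - 1, specialCol T)

/-- The index `sp(T)` of the horizontal border edge under the special point. -/
def sp (T : Filling) : ℕ := (Edge.below (specialCol T)).index T.shape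

/-- The ribbon along the border of `ν` from `p` to `s` (with `s` to the Northeast of `p`): it
starts in the cell to the right of `p`, ends in the cell under `s`, and consists of the cells
outside `ν` that touch the border of `ν`, i.e. whose upper left neighbour lies in `ν`. -/
def ribbon (ν : YoungDiagram) (p s : ℕ × ℕ) : Finset (ℕ × ℕ) :=
  (Finset.Ioc s.1 p.1 ×ˢ Finset.Ioc p.2 s.2).filter
    fun q => q ∉ ν ∧ (q.1 - 1, q.2 - 1) ∈ ν

/-- The diagram `ν` with the ribbon from `p` to `s` added (`p` and `s` being cells of `ν`). -/
def addRibbon (ν : YoungDiagram) (p s : ℕ × ℕ) : YoungDiagram :=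
  if h : p ∈ ν ∧ s ∈ ν then
    { cells := ν.cells ∪ ribbon ν p s
      isLowerSet := by
        obtain ⟨hp, hs⟩ := h
        rintro ⟨a, b⟩ ⟨c, d⟩ hle hab
        obtain ⟨h1, h2⟩ : c ≤ a ∧ d ≤ b := hle
        simp only [Finset.mem_coe, Finset.mem_union, YoungDiagram.mem_cells, ribbon,
          Finset.mem_filter, Finset.mem_product, Finset.mem_Ioc] at hab ⊢
        rcases hab with hm | ⟨⟨⟨h3, h4⟩, h5, h6⟩, _, hm⟩
        · exact Or.inl (ν.up_left_mem h1 h2 hm)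
        · by_cases hcd : (c, d) ∈ ν
          · exact Or.inl hcd
          · refine Or.inr ⟨⟨⟨?_, by omega⟩, ?_, by omega⟩, hcd,
              ν.up_left_mem (by omega) (by omega) hm⟩
            · by_contra hc
              exact hcd (ν.up_left_mem (by omega) (by omega) hs)
            · by_contra hd
              exact hcd (ν.up_left_mem (by omega) (by omega) hp) }
  else ν

theorem le_addRibbon (ν : YoungDiagram) (p s : ℕ × ℕ) : ν.cells ⊆ (addRibbon ν p s).cells := by
  unfold addRibbon
  split_ifs
  · exact Finset.subset_union_left
  · exact subset_rfl

/-- The diagram of the tableau obtained by inserting a point at the border edge `e`: a row or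
column is inserted, and if the index of `e` is smaller than `sp(T)`, the ribbon from the new point
to the special point of `T` is added. -/
def insertShape (T : Filling) (e : Edge) : YoungDiagram :=
  if sp T ≤ e.index T.shape then insertLine T.shape e
  else addRibbon (insertLine T.shape e) (newCell T.shape e) (shift T.shape e (specialPoint T))

theorem insertLine_subset (T : Filling) (e : Edge) :
    (insertLine T.shape e).cells ⊆ (insertShape T e).cells := by
  unfold insertShape
  split_ifs
  · exact subset_rfl
  · exact le_addRibbon _ _ _

theorem newCell_mem_newLine (μ : YoungDiagram) (e : Edge) : newCell μ e ∈ newLine μ e := by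
  cases e <;> simp [newCell, newLine]

/-- The insertion algorithm `Insertpoint`. -/
def insertPoint (T : Filling) (e : Edge) : Filling where
  shape := insertShape T e
  points := insert (newCell T.shape e) (T.points.image (shift T.shape e))
  points_subset := by
    refine Finset.Subset.trans ?_ (insertLine_subset T e)
    intro p hp
    rcases Finset.mem_insert.1 hp with rfl | hp
    · exact Finset.mem_union_right _ (newCell_mem_newLine _ _)
    · exact Finset.mem_union_left _ (Finset.image_subset_image T.points_subset hp)

/-- The tree-like tableau of size `1`: a single cell, containing a point. -/
def single : Filling where
  shape := ⟨{(0, 0)}, by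
    rintro ⟨a, b⟩ ⟨c, d⟩ h hab
    simp_all [Prod.le_def]⟩
  points := {(0, 0)}
  points_subset := subset_rfl

/-- The tableau of size `n` (for `1 ≤ n`) obtained from the tableau of size `1` by inserting
points successively at the edges `E 2, E 3, …, E n`. -/
def stage (E : ℕ → Edge) : ℕ → Filling
  | 0 => single
  | 1 => single
  | n + 2 => insertPoint (stage E (n + 1)) (E (n + 2))

/-- The cell, in the tableau of size `n`, of the point `p_k` that was added when inserting at
`E k` (for `2 ≤ k ≤ n`; for `k = 1` it is the root point). It moves along with the rows and columns
during the later insertions. -/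
def pointCell (E : ℕ → Edge) (k : ℕ) : ℕ → ℕ × ℕ
  | 0 => (0, 0)
  | 1 => (0, 0)
  | n + 2 =>
    if n + 2 = k then newCell (stage E (n + 1)).shape (E k)
    else shift (stage E (n + 1)).shape (E (n + 2)) (pointCell E k (n + 1))

/-- `E 2, …, E n` are successive border edges at which insertion produces the tableau `T`. -/
def IsInsertionSequence (n : ℕ) (E : ℕ → Edge) (T : Filling) : Prop :=
  (∀ k, 2 ≤ k → k ≤ n → (E k).IsBorder (stage E (k - 1)).shape) ∧ stage E n = T

/-- In the tableau `T` of size `n`, the `k`-th inserted point `p_k` lies in a corner. -/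
def PointInCorner (n k : ℕ) (T : Filling) : Prop :=
  ∃ E : ℕ → Edge, IsInsertionSequence n E T ∧ IsCorner T.shape (pointCell E k n)

/-- The number of tree-like tableaux of size `n` having `p_k` in a corner. -/
noncomputable def cornerCount (n k : ℕ) : ℕ := {T ∈ tableaux n | PointInCorner n k T}.ncard

end TreeLike

/-! ### Cells, bottom points and the special point. -/

namespace TreeLike

/-! Insertion factors into two reversible steps. `plainInsert` inserts the row or column with its
point, which then lies in a corner; `close` adds the ribbon from that corner to the special point of
the intermediate filling. The special point of the result is the new point, so the last insertion
can be read off. The ribbon is undone by cutting the border strip from the special point up to the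
first point met on it (`close_injective`, `exists_close_eq`), and the line is undone by deleting the
row or column of the corner (`plainInsert_injective`, `exists_plainInsert_eq`). Hence every tableau
of size n + 1 arises exactly once from a tableau of size n and one of its n + 1 border edges; this
gives unique insertion sequences and n! tableaux.

For the count, fix the index i of the edge under p_k. By `sp_insertPoint`, inserting at e_i makes
`sp` equal to i, and by `isCorner_newCell_iff` the new point is in a corner iff the old `sp` was at
most i. This leaves (k-2)! min(i, k-1) tableaux of size k - 1. By `isCorner_shift_iff` the point
then stays in a corner, with the same i, iff each later insertion has index at least i + 2, that is
m - i choices when passing from size m to m + 1. With d = n - k the number for i is therefore (k-2)!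
min(i, k-1) (k-i)(k-i+1)...(k-i+d-1) (`ncard_cornerSet`).

The terms i < k sum, by two discrete integrations of rising factorials, to n!/((d+1)(d+2)). The term
i = k vanishes unless d = 0, when it is (n-1)!. The sum over k telescopes to n!. It counts occupied
corners, because for n ≥ 2 the root is not in a corner. -/

theorem mem_insertLine_below {μ : YoungDiagram} {j x y : ℕ} :
    (x, y) ∈ insertLine μ (.below j) ↔
      (x < μ.colLen j ∧ (x, y) ∈ μ) ∨ (μ.colLen j < x ∧ (x - 1, y) ∈ μ) ∨
        (x = μ.colLen j ∧ y ≤ j) :=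
  mem_insert_below μ j x y

theorem mem_insertLine_right {μ : YoungDiagram} {i x y : ℕ} :
    (x, y) ∈ insertLine μ (.right i) ↔
      (y < μ.rowLen i ∧ (x, y) ∈ μ) ∨ (μ.rowLen i < y ∧ (x, y - 1) ∈ μ) ∨
        (y = μ.rowLen i ∧ x ≤ i) :=
  mem_insert_right μ i x y

theorem mem_addRibbon {ν : YoungDiagram} {p s : ℕ × ℕ} (hp : p ∈ ν) (hs : s ∈ ν) {x y : ℕ} :
    (x, y) ∈ addRibbon ν p s ↔ (x, y) ∈ ν ∨
      ((s.1 < x ∧ x ≤ p.1) ∧ (p.2 < y ∧ y ≤ s.2) ∧ (x - 1, y - 1) ∈ ν) := by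
  unfold addRibbon
  rw [dif_pos ⟨hp, hs⟩, ← YoungDiagram.mem_cells]
  simp only [Finset.mem_union, ribbon, Finset.mem_filter, Finset.mem_product, Finset.mem_Ioc,
    YoungDiagram.mem_cells]
  tauto

theorem mem_iff_col {μ : YoungDiagram} (x y : ℕ) : (x, y) ∈ μ ↔ x < μ.colLen y :=
  YoungDiagram.mem_iff_lt_colLen

theorem mem_iff_row {μ : YoungDiagram} (x y : ℕ) : (x, y) ∈ μ ↔ y < μ.rowLen x :=
  YoungDiagram.mem_iff_lt_rowLen

theorem colLen_eq_iff {μ : YoungDiagram} {y m : ℕ} :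
    μ.colLen y = m ↔ ∀ x, (x, y) ∈ μ ↔ x < m := by
  refine ⟨fun h x => h ▸ mem_iff_col x y, fun h => eq_of_forall_lt_iff fun x => ?_⟩
  rw [← mem_iff_col, h]

theorem rowLen_eq_iff {μ : YoungDiagram} {x m : ℕ} :
    μ.rowLen x = m ↔ ∀ y, (x, y) ∈ μ ↔ y < m := by
  refine ⟨fun h y => h ▸ mem_iff_row x y, fun h => eq_of_forall_lt_iff fun y => ?_⟩
  rw [← mem_iff_row, h]

theorem bottom_iff {μ : YoungDiagram} {x y : ℕ} (h : (x, y) ∈ μ) :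
    μ.colLen y - 1 = x ↔ (x + 1, y) ∉ μ := by
  rw [mem_iff_col] at h ⊢
  omega

theorem mem_of_le {μ : YoungDiagram} {q : ℕ × ℕ} {x y : ℕ} (h : q ∈ μ) (h1 : x ≤ q.1)
    (h2 : y ≤ q.2) : (x, y) ∈ μ :=
  μ.up_left_mem h1 h2 h

namespace Filling

/-- A point that lies in the bottom cell of its column. -/
def IsBottom (T : Filling) (q : ℕ × ℕ) : Prop := q ∈ T.points ∧ (q.1 + 1, q.2) ∉ T.shape

theorem mem_shape {T : Filling} {q : ℕ × ℕ} (h : q ∈ T.points) : q ∈ T.shape :=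
  T.points_subset h

theorem mem_specialCol_iff {T : Filling} {c : ℕ} :
    c ∈ ((Finset.range (T.shape.rowLen 0)).filter
      fun c => (T.shape.colLen c - 1, c) ∈ T.points) ↔ ∃ x, T.IsBottom (x, c) := by
  simp only [Finset.mem_filter, Finset.mem_range]
  constructor
  · rintro ⟨-, h⟩
    exact ⟨_, h, (bottom_iff (T.mem_shape h)).1 rfl⟩
  · rintro ⟨x, hx, hb⟩
    rw [(bottom_iff (T.mem_shape hx)).2 hb, ← mem_iff_row]
    exact ⟨T.shape.up_left_mem (Nat.zero_le _) le_rfl (T.mem_shape hx), hx⟩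

theorem specialPoint_eq {T : Filling} {q : ℕ × ℕ} (hq : T.IsBottom q)
    (h : ∀ q', T.IsBottom q' → q'.2 ≤ q.2) : specialPoint T = q := by
  have hc : specialCol T = q.2 := by
    refine le_antisymm (Finset.sup_le fun c hc => ?_) ?_
    · obtain ⟨x, hx⟩ := mem_specialCol_iff.1 hc
      exact h _ hx
    · exact Finset.le_sup (f := id) (mem_specialCol_iff.2 ⟨q.1, hq⟩)
  rw [specialPoint, hc, (bottom_iff (T.mem_shape hq.1)).2 hq.2]

theorem specialPoint_snd (T : Filling) : (specialPoint T).2 = specialCol T := rfl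

/-- The last row is not empty, and each of its points is at the bottom of its column. -/
theorem IsTreeLike.exists_isBottom {T : Filling} (hT : T.IsTreeLike) : ∃ q, T.IsBottom q := by
  have h0 := T.mem_shape hT.root
  have h1 := (mem_iff_col 0 0).1 h0
  obtain ⟨p, hp, hr⟩ := hT.row (T.shape.colLen 0 - 1) (by omega)
  refine ⟨p, hp, fun h => ?_⟩
  have := (mem_iff_col _ _).1 (T.shape.up_left_mem le_rfl (Nat.zero_le _) h)
  omega

theorem IsTreeLike.isBottom_specialPoint {T : Filling} (hT : T.IsTreeLike) :
    T.IsBottom (specialPoint T) := by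
  obtain ⟨q, hq⟩ := hT.exists_isBottom
  -- Without a bottom point the supremum defining `specialCol` would be the default value 0;
  -- nonemptiness makes it an attained maximum.
  have hne : ((Finset.range (T.shape.rowLen 0)).filter
      fun c => (T.shape.colLen c - 1, c) ∈ T.points).Nonempty :=
    ⟨q.2, mem_specialCol_iff.2 ⟨q.1, hq⟩⟩
  obtain ⟨c, hc, he⟩ := Finset.exists_mem_eq_sup _ hne id
  have he : specialCol T = c := he
  have hc' := (Finset.mem_filter.1 hc).2
  rw [specialPoint, he]
  exact ⟨hc', (bottom_iff (T.mem_shape hc')).1 rfl⟩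

theorem IsBottom.le_specialPoint {T : Filling} {q : ℕ × ℕ} (hq : T.IsBottom q) :
    q.2 ≤ (specialPoint T).2 :=
  Finset.le_sup (f := id) (mem_specialCol_iff.2 ⟨q.1, hq⟩)

theorem IsBottom.eq_of_snd_eq {T : Filling} {q q' : ℕ × ℕ} (hq : T.IsBottom q)
    (hq' : T.IsBottom q') (h : q.2 = q'.2) : q = q' := by
  refine Prod.ext ?_ h
  rw [← (bottom_iff (T.mem_shape hq.1)).2 hq.2, ← (bottom_iff (T.mem_shape hq'.1)).2 hq'.2, h]

/-- The filling obtained by adding the ribbon from `p` to the special point. -/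
def close (F : Filling) (p : ℕ × ℕ) : Filling where
  shape := addRibbon F.shape p (specialPoint F)
  points := F.points
  points_subset := F.points_subset.trans (le_addRibbon _ _ _)

/-- A point that lies in a corner. -/
def IsOccupiedCorner (F : Filling) (p : ℕ × ℕ) : Prop := p ∈ F.points ∧ IsCorner F.shape p

theorem IsOccupiedCorner.isBottom {F : Filling} {p : ℕ × ℕ} (h : F.IsOccupiedCorner p) :
    F.IsBottom p := ⟨h.1, h.2.2.1⟩

/-! ### Adding a ribbon. -/

section Close

variable {F : Filling} {p : ℕ × ℕ}

theorem mem_close (hF : F.IsTreeLike) (hp : F.IsOccupiedCorner p) {x y : ℕ} :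
    (x, y) ∈ (F.close p).shape ↔ (x, y) ∈ F.shape ∨
      (((specialPoint F).1 < x ∧ x ≤ p.1) ∧ (p.2 < y ∧ y ≤ (specialPoint F).2) ∧
        (x - 1, y - 1) ∈ F.shape) :=
  mem_addRibbon hp.2.1 (mem_shape hF.isBottom_specialPoint.1)

/-- A cell in the box spanned by the ribbon belongs to the diagram before adding the ribbon if and
only if its lower right neighbour belongs to the diagram afterwards. -/
theorem mem_iff_succ_mem_close (hF : F.IsTreeLike) (hp : F.IsOccupiedCorner p) {x y : ℕ}
    (h1 : (specialPoint F).1 < x + 1 ∧ x ≤ p.1) (h2 : p.2 < y + 1 ∧ y ≤ (specialPoint F).2)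
    (h3 : x < p.1 ∨ p.2 < y) (h4 : y < (specialPoint F).2 ∨ (specialPoint F).1 < x) :
    (x, y) ∈ F.shape ↔ (x + 1, y + 1) ∈ (F.close p).shape := by
  have hs := hF.isBottom_specialPoint
  obtain ⟨-, hp1, hp2, hp3⟩ := id hp
  rw [mem_close hF hp]
  constructor
  -- If the neighbour left the box, the cell to the right of `p` or the cell below the special point
  -- would belong to the diagram; `h3` and `h4` exclude `p` and the special point themselves, for
  -- which this argument fails.
  · intro h
    refine Or.inr ⟨⟨h1.1, ?_⟩, ⟨h2.1, ?_⟩, h⟩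
    · by_contra hx
      exact hp3 (mem_of_le h (by omega) (by omega))
    · by_contra hy
      exact hs.2 (mem_of_le h (by omega) (by omega))
  · rintro (h | ⟨-, -, h⟩)
    · exact mem_of_le h (by omega) (by omega)
    · exact h

/-- The points do not change, and the ribbon avoids the first row and the first column, so no new
row or column appears. -/
theorem close_isTreeLike (hF : F.IsTreeLike) (hp : F.IsOccupiedCorner p) :
    (F.close p).IsTreeLike := by
  refine ⟨hF.root, hF.parent, fun r hr => hF.row r ?_, fun c hc => hF.col c ?_⟩
  · rw [← mem_iff_col, mem_close hF hp] at hr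
    rw [← mem_iff_col]
    rcases hr with h | h
    · exact h
    · omega
  · rw [← mem_iff_row, mem_close hF hp] at hc
    rw [← mem_iff_row]
    rcases hc with h | h
    · exact h
    · omega

theorem specialPoint_fst_le (hF : F.IsTreeLike) (hp : F.IsOccupiedCorner p)
    (h : p.2 < (specialPoint F).2) : (specialPoint F).1 < p.1 := by
  by_contra h'
  exact hp.2.2.2 (mem_of_le (mem_shape hF.isBottom_specialPoint.1) (by omega) (by omega))

/-- The ribbon puts a cell under every bottom point to the right of `p`, and none under `p`. -/
theorem specialPoint_close (hF : F.IsTreeLike) (hp : F.IsOccupiedCorner p) :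
    specialPoint (F.close p) = p := by
  have hs := hF.isBottom_specialPoint
  obtain ⟨hp0, hp1, hp2, hp3⟩ := id hp
  refine specialPoint_eq ⟨hp0, ?_⟩ fun q hq => ?_
  · rw [mem_close hF hp]
    rintro (h | h)
    · exact hp2 h
    · omega
  · obtain ⟨hq1, hq2⟩ := hq
    by_contra! hlt
    have hqF : q ∈ F.shape := mem_shape (T := F) hq1
    rw [mem_close hF hp] at hq2
    push Not at hq2
    obtain ⟨h1, h2⟩ := hq2
    have hle := IsBottom.le_specialPoint (T := F) ⟨hq1, h1⟩
    refine h2 ⟨?_, ?_⟩ ⟨hlt, hle⟩ (mem_of_le hqF (by omega) (by omega))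
    · by_contra hx
      exact h1 (mem_of_le (mem_shape hs.1) (by omega) hle)
    · by_contra hx
      exact hp3 (mem_of_le hqF (by omega) (by omega))

/-- The ribbon is empty exactly when it would start and end at `p`; otherwise it covers the cell to
the right of `p`. -/
theorem isCorner_close_iff (hF : F.IsTreeLike) (hp : F.IsOccupiedCorner p) :
    IsCorner (F.close p).shape p ↔ specialPoint F = p := by
  have hs := hF.isBottom_specialPoint
  have hle := hp.isBottom.le_specialPoint
  obtain ⟨hp0, hp1, hp2, hp3⟩ := id hp
  constructor
  · rintro ⟨-, -, h⟩
    rw [mem_close hF hp] at h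
    push Not at h
    rcases hle.eq_or_lt with h' | h'
    · exact hs.eq_of_snd_eq hp.isBottom h'.symm
    · have := specialPoint_fst_le hF hp h'
      exact absurd (mem_of_le hp1 (by omega) (by omega))
        (h.2 ⟨this, le_rfl⟩ ⟨by omega, by omega⟩)
  · intro h
    refine ⟨(le_addRibbon _ _ _) hp1, ?_, ?_⟩
    all_goals
      rw [mem_close hF hp, h]
      rintro (h | h)
      · first | exact hp2 h | exact hp3 h
      · omega

/-- Recovers the diagram from its closure once both ends of the ribbon are known: the ribbon is the
part of the border strip inside the box. -/
theorem mem_shape_iff_mem_close (hF : F.IsTreeLike) (hp : F.IsOccupiedCorner p) {x y : ℕ} :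
    (x, y) ∈ F.shape ↔ (x, y) ∈ (F.close p).shape ∧
      (((specialPoint F).1 < x ∧ x ≤ p.1) ∧ (p.2 < y ∧ y ≤ (specialPoint F).2) →
        (x + 1, y + 1) ∈ (F.close p).shape) := by
  constructor
  · intro h
    refine ⟨(mem_close hF hp).2 (Or.inl h), fun hb => ?_⟩
    exact (mem_iff_succ_mem_close hF hp (by omega) (by omega) (by omega) (by omega)).1 h
  · rintro ⟨h1, h2⟩
    rcases (mem_close hF hp).1 h1 with h | h
    · exact h
    · exact (mem_iff_succ_mem_close hF hp (by omega) (by omega) (by omega) (by omega)).2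
        (h2 ⟨h.1, h.2.1⟩)

/-- Half of the fact that the closure determines the upper end of the ribbon. If the special point
of `F` were further right, its ribbon would pass the special point `s'` of `F'`. But `s'` is a point
of `F` too, so its lower right neighbour would lie in the common closure, whereas the ribbon of `F'`
stops under `s'`. -/
theorem specialPoint_snd_le_of_close_eq {F' : Filling} (hF : F.IsTreeLike)
    (hp : F.IsOccupiedCorner p) (hF' : F'.IsTreeLike) (hp' : F'.IsOccupiedCorner p)
    (h : F.close p = F'.close p) : (specialPoint F).2 ≤ (specialPoint F').2 := by
  by_contra! hlt
  have hpts : F.points = F'.points := (congrArg Filling.points h :)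
  have hs := hF.isBottom_specialPoint
  have hs' := hF'.isBottom_specialPoint
  have hle := hp'.isBottom.le_specialPoint
  have h1 : (specialPoint F').1 ≤ p.1 := by
    have := mem_shape hs'.1
    by_contra! hx
    exact hp'.2.2.1 (mem_of_le this hx hle)
  have hs1 : (specialPoint F').1 + 1 > (specialPoint F).1 := by
    by_contra! hx
    have h2 : ((specialPoint F').1 + 1, (specialPoint F').2) ∈ F.shape :=
      mem_of_le (mem_shape hs.1) hx hlt.le
    have h3 : ((specialPoint F').1 + 1, (specialPoint F').2 + 1) ∈ F.shape :=
      mem_of_le (mem_shape hs.1) hx hlt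
    have h4 := (mem_close hF hp).2 (Or.inl h3)
    rw [h, mem_close hF' hp'] at h4
    rcases h4 with h4 | h4
    · exact hs'.2 (mem_of_le h4 le_rfl (by omega))
    · omega
  have h5 : (specialPoint F').1 = p.1 → (specialPoint F').2 ≤ p.2 := by
    intro h6
    by_contra! hx
    have := specialPoint_fst_le hF' hp' hx
    omega
  have h7 : ((specialPoint F').1, (specialPoint F').2) ∈ F.shape := by
    apply mem_shape; rw [hpts]; exact hs'.1
  -- If `s'` is in the column of `p`, it equals `p` and both ribbons are empty; otherwise the
  -- diagonal shift applies to `s'`.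
  rcases hle.eq_or_lt with h8 | h8
  · have h9 : specialPoint F' = p := hs'.eq_of_snd_eq hp'.isBottom h8.symm
    have h10 := (isCorner_close_iff hF' hp').2 h9
    rw [← h, isCorner_close_iff hF hp] at h10
    rw [h9, h10] at hlt
    exact lt_irrefl _ hlt
  · rw [mem_iff_succ_mem_close hF hp ⟨hs1, h1⟩ (by omega) (by omega) (by omega), h,
      mem_close hF' hp'] at h7
    rcases h7 with h7 | h7
    · exact hs'.2 (mem_of_le h7 le_rfl (by omega))
    · omega

theorem close_injective {F' : Filling} {p' : ℕ × ℕ} (hF : F.IsTreeLike)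
    (hp : F.IsOccupiedCorner p) (hF' : F'.IsTreeLike) (hp' : F'.IsOccupiedCorner p')
    (h : F.close p = F'.close p') : F = F' ∧ p = p' := by
  obtain rfl : p = p' := by
    rw [← specialPoint_close hF hp, h, specialPoint_close hF' hp']
  refine ⟨?_, rfl⟩
  have hpts : F.points = F'.points := (congrArg Filling.points h :)
  have hs := hF.isBottom_specialPoint
  have hs' := hF'.isBottom_specialPoint
  have hcol : (specialPoint F).2 = (specialPoint F').2 :=
    le_antisymm (specialPoint_snd_le_of_close_eq hF hp hF' hp' h)
      (specialPoint_snd_le_of_close_eq hF' hp' hF hp h.symm)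
  have hrow : (specialPoint F).1 = (specialPoint F').1 := by
    have m1 : specialPoint F ∈ F'.shape := by
      apply mem_shape; rw [← hpts]; exact hs.1
    have m2 : specialPoint F' ∈ F.shape := by
      apply mem_shape; rw [hpts]; exact hs'.1
    apply le_antisymm
    · by_contra! hx
      exact hs'.2 (mem_of_le m1 hx hcol.ge)
    · by_contra! hx
      exact hs.2 (mem_of_le m2 hx hcol.le)
  refine Filling.ext ?_ hpts
  ext ⟨x, y⟩
  rw [YoungDiagram.mem_cells, YoungDiagram.mem_cells, mem_shape_iff_mem_close hF hp,
    mem_shape_iff_mem_close hF' hp', h, hcol, hrow]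

end Close

end Filling

end TreeLike

/-! ### Removing a ribbon. -/

namespace TreeLike

namespace Filling

/-- The diagram obtained by removing the border strip between the points `p` and `s`. -/
def removeStrip (μ : YoungDiagram) (p s : ℕ × ℕ) (hp : (p.1 + 1, p.2 + 1) ∉ μ)
    (hs : (s.1 + 1, s.2 + 1) ∉ μ) : YoungDiagram where
  cells := μ.cells.filter fun q =>
    (s.1 < q.1 ∧ q.1 ≤ p.1) ∧ (p.2 < q.2 ∧ q.2 ≤ s.2) → (q.1 + 1, q.2 + 1) ∈ μ
  isLowerSet := by
    rintro ⟨a, b⟩ ⟨c, d⟩ hle hab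
    obtain ⟨h1, h2⟩ : c ≤ a ∧ d ≤ b := hle
    simp only [Finset.mem_coe, Finset.mem_filter, YoungDiagram.mem_cells] at hab ⊢
    refine ⟨mem_of_le hab.1 h1 h2, fun hbox => ?_⟩
    by_cases hbox' : (s.1 < a ∧ a ≤ p.1) ∧ (p.2 < b ∧ b ≤ s.2)
    · exact mem_of_le (hab.2 hbox') (by simpa using h1) (by simpa using h2)
    · exfalso
      by_cases ha : p.1 < a
      · exact hp (mem_of_le hab.1 ha (by change _ ≤ b; omega))
      · exact hs (mem_of_le hab.1 (by change _ ≤ a; omega) (by change _ ≤ b; omega))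

theorem mem_removeStrip {μ : YoungDiagram} {p s : ℕ × ℕ} (hp : (p.1 + 1, p.2 + 1) ∉ μ)
    (hs : (s.1 + 1, s.2 + 1) ∉ μ) {x y : ℕ} : (x, y) ∈ removeStrip μ p s hp hs ↔ (x, y) ∈ μ ∧
      ((s.1 < x ∧ x ≤ p.1) ∧ (p.2 < y ∧ y ≤ s.2) → (x + 1, y + 1) ∈ μ) := by
  rw [← YoungDiagram.mem_cells]
  simp only [removeStrip, Finset.mem_filter, YoungDiagram.mem_cells]

/-- Starting at the special point `p`, follow the border strip to the Northeast up to the first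
point `s` on it, and cut out the cells strictly between them. This frees the right side of `p` and
the bottom of `s`. If nothing lies to the right of `p`, nothing is cut. -/
theorem exists_close_eq {T : Filling} (hT : T.IsTreeLike) :
    ∃ F : Filling, F.IsTreeLike ∧ F.IsOccupiedCorner (specialPoint T) ∧
      F.close (specialPoint T) = T := by
  have hp := hT.isBottom_specialPoint
  have hpm := mem_shape hp.1
  have hmax : ∀ q, T.IsBottom q → q.2 ≤ (specialPoint T).2 := fun q hq => hq.le_specialPoint
  generalize specialPoint T = p at *
  by_cases hc : (p.1, p.2 + 1) ∈ T.shape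
  swap
  · have hs : specialPoint T = p := specialPoint_eq hp hmax
    have hcor : T.IsOccupiedCorner p := ⟨hp.1, hpm, hp.2, hc⟩
    refine ⟨T, hT, hcor, Filling.ext ?_ rfl⟩
    ext ⟨x, y⟩
    rw [YoungDiagram.mem_cells, mem_close hT hcor, hs, YoungDiagram.mem_cells]
    constructor
    · rintro (h | h)
      · exact h
      · omega
    · exact Or.inl
  have hp1 : (p.1 + 1, p.2 + 1) ∉ T.shape := fun h => hp.2 (mem_of_le h le_rfl (Nat.le_succ _))
  -- The candidates for `s` are the points of the border strip to the right of `p`; a point of the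
  -- last column is one of them.
  have hne : (T.points.filter fun q => p.2 < q.2 ∧ (q.1 + 1, q.2 + 1) ∉ T.shape).Nonempty := by
    have h0 : p.2 + 1 < T.shape.rowLen 0 := by
      rw [← mem_iff_row]
      exact mem_of_le hc (Nat.zero_le _) le_rfl
    obtain ⟨q, hq, hq2⟩ := hT.col (T.shape.rowLen 0 - 1) (by omega)
    refine ⟨q, Finset.mem_filter.2 ⟨hq, by omega, fun h => ?_⟩⟩
    have := (mem_iff_row _ _).1 (mem_of_le h (Nat.zero_le _) le_rfl)
    omega
  -- Column minus row increases along the strip, so its minimum selects the first point after `p`.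
  obtain ⟨s, hsm, hmin⟩ := Finset.exists_min_image _ (fun q : ℕ × ℕ => (q.2 : ℤ) - q.1) hne
  rw [Finset.mem_filter] at hsm
  obtain ⟨hsp, hps, hs1⟩ := hsm
  -- `p` is the right-most bottom point, so `s` cannot be one.
  have hs2 : (s.1 + 1, s.2) ∈ T.shape := by
    by_contra h
    have := hmax s ⟨hsp, h⟩
    omega
  have hlt : s.1 < p.1 := by
    by_contra! h
    exact hp1 (mem_of_le hs2 (by change _ ≤ s.1 + 1; omega) hps)
  -- A removed point would lie strictly below `s` and not to its right, contradicting the minimality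
  -- of `s`.
  have hsub : T.points ⊆ (removeStrip T.shape p s hp1 hs1).cells := by
    intro q hq
    obtain ⟨x, y⟩ := q
    rw [YoungDiagram.mem_cells, mem_removeStrip]
    refine ⟨mem_shape hq, fun hbox => ?_⟩
    by_contra h
    have := hmin (x, y) (Finset.mem_filter.2 ⟨hq, hbox.2.1, h⟩)
    dsimp only at this
    omega
  let F : Filling := ⟨removeStrip T.shape p s hp1 hs1, T.points, hsub⟩
  have hmem : ∀ {x y : ℕ}, (x, y) ∈ F.shape ↔ (x, y) ∈ T.shape ∧
      ((s.1 < x ∧ x ≤ p.1) ∧ (p.2 < y ∧ y ≤ s.2) → (x + 1, y + 1) ∈ T.shape) :=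
    mem_removeStrip hp1 hs1
  have hF : F.IsTreeLike := by
    refine ⟨hT.root, hT.parent, fun r hr => hT.row r ?_, fun c hc => hT.col c ?_⟩
    · rw [← mem_iff_col] at hr ⊢
      exact (hmem.1 hr).1
    · rw [← mem_iff_row] at hc ⊢
      exact (hmem.1 hc).1
  have hcor : F.IsOccupiedCorner p := by
    refine ⟨hp.1, mem_shape (T := F) hp.1, fun h => hp.2 (hmem.1 h).1, fun h => ?_⟩
    exact hp1 (mem_of_le ((hmem.1 h).2 ⟨⟨hlt, le_rfl⟩, Nat.lt_succ_self _, hps⟩) le_rfl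
      (Nat.le_succ _))
  have hspec : specialPoint F = s := by
    refine specialPoint_eq ⟨hsp, fun h => ?_⟩ fun q hq => ?_
    · exact hs1 (mem_of_le ((hmem.1 h).2 ⟨⟨Nat.lt_succ_self _, hlt⟩, hps, le_rfl⟩)
        (Nat.le_succ _) le_rfl)
    · by_contra! hlt'
      have := hmax q ⟨hq.1, fun h => hq.2 (hmem.2 ⟨h, fun h' => by omega⟩)⟩
      omega
  refine ⟨F, hF, hcor, Filling.ext ?_ rfl⟩
  ext ⟨x, y⟩
  rw [YoungDiagram.mem_cells, mem_close hF hcor, hspec, YoungDiagram.mem_cells]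
  constructor
  · rintro (h | ⟨hx, hy, h⟩)
    · exact (hmem.1 h).1
    · obtain ⟨h3, h4⟩ := hmem.1 h
      -- Outside the box the cell is weakly Northwest of the cell under `s` or of the cell right of
      -- `p`, both of which belong to `T`.
      by_cases hbox : (s.1 < x - 1 ∧ x - 1 ≤ p.1) ∧ (p.2 < y - 1 ∧ y - 1 ≤ s.2)
      · exact mem_of_le (h4 hbox) (by change _ ≤ x - 1 + 1; omega) (by change _ ≤ y - 1 + 1; omega)
      · by_cases hx' : x = s.1 + 1
        · exact mem_of_le hs2 hx'.le hy.2
        · exact mem_of_le hc hx.2 (by change _ ≤ p.2 + 1; omega)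
  · intro h
    by_cases h' : (x, y) ∈ F.shape
    · exact Or.inl h'
    · rw [hmem] at h'
      push Not at h'
      obtain ⟨⟨hx, hy⟩, -⟩ := h' h
      refine Or.inr ⟨hx, hy, hmem.2 ⟨mem_of_le h (Nat.sub_le _ _) (Nat.sub_le _ _), fun hb => ?_⟩⟩
      rwa [Nat.sub_add_cancel (by omega), Nat.sub_add_cancel (by omega)]

end Filling

end TreeLike

/-! ### Reflection, and insertion of a line without ribbon. -/

namespace TreeLike

/-- Reflection of an edge in the main diagonal. -/
def Edge.transpose : Edge → Edge
  | .below c => .right c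
  | .right r => .below r

namespace Filling

/-- There is a point above the cell `(x, y)`. -/
def HasAbove (T : Filling) (x y : ℕ) : Prop := ∃ x' < x, (x', y) ∈ T.points

/-- There is a point to the left of the cell `(x, y)`. -/
def HasLeft (T : Filling) (x y : ℕ) : Prop := ∃ y' < y, (x, y') ∈ T.points

theorem isTreeLike_iff {T : Filling} : T.IsTreeLike ↔ (0, 0) ∈ T.points ∧
    (∀ x y, (x, y) ∈ T.points → (x, y) ≠ (0, 0) → Xor (T.HasAbove x y) (T.HasLeft x y)) ∧
    (∀ x, (x, 0) ∈ T.shape → ∃ y, (x, y) ∈ T.points) ∧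
    (∀ y, (0, y) ∈ T.shape → ∃ x, (x, y) ∈ T.points) := by
  have ha : ∀ x y, (∃ q ∈ T.points, q.2 = y ∧ q.1 < x) ↔ T.HasAbove x y := fun x y =>
    ⟨fun ⟨q, hq, h1, h2⟩ => ⟨q.1, h2, h1 ▸ hq⟩, fun ⟨x', h1, h2⟩ => ⟨_, h2, rfl, h1⟩⟩
  have hl : ∀ x y, (∃ q ∈ T.points, q.1 = x ∧ q.2 < y) ↔ T.HasLeft x y := fun x y =>
    ⟨fun ⟨q, hq, h1, h2⟩ => ⟨q.2, h2, h1 ▸ hq⟩, fun ⟨x', h1, h2⟩ => ⟨_, h2, rfl, h1⟩⟩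
  have hr : ∀ x, (∃ p ∈ T.points, p.1 = x) ↔ ∃ y, (x, y) ∈ T.points := fun x =>
    ⟨fun ⟨q, hq, h⟩ => ⟨q.2, h ▸ hq⟩, fun ⟨y, h⟩ => ⟨_, h, rfl⟩⟩
  have hc : ∀ y, (∃ p ∈ T.points, p.2 = y) ↔ ∃ x, (x, y) ∈ T.points := fun x =>
    ⟨fun ⟨q, hq, h⟩ => ⟨q.1, h ▸ hq⟩, fun ⟨y, h⟩ => ⟨_, h, rfl⟩⟩
  constructor
  · rintro ⟨h1, h2, h3, h4⟩
    refine ⟨h1, fun x y h h' => ?_, fun x h => (hr x).1 (h3 x ((mem_iff_col _ _).1 h)),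
      fun y h => (hc y).1 (h4 y ((mem_iff_row _ _).1 h))⟩
    rw [← ha, ← hl]
    exact h2 _ h h'
  · rintro ⟨h1, h2, h3, h4⟩
    refine ⟨h1, fun p h h' => ?_, fun x h => (hr x).2 (h3 x ((mem_iff_col _ _).2 h)),
      fun y h => (hc y).2 (h4 y ((mem_iff_row _ _).2 h))⟩
    rw [ha, hl]
    exact h2 _ _ h h'

/-- Reflection of a filling in the main diagonal. -/
def transpose (T : Filling) : Filling where
  shape := T.shape.transpose
  points := T.points.map (Equiv.prodComm ℕ ℕ).toEmbedding
  points_subset := by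
    rintro ⟨x, y⟩ h
    simp only [Finset.mem_map_equiv, Equiv.prodComm_symm, Equiv.prodComm_apply, Prod.swap_prod_mk]
      at h
    rw [YoungDiagram.mem_cells, YoungDiagram.mem_transpose]
    exact mem_shape h

theorem mem_transpose_points {T : Filling} {x y : ℕ} :
    (x, y) ∈ T.transpose.points ↔ (y, x) ∈ T.points := by
  simp [transpose, Finset.mem_map_equiv]

theorem mem_transpose_shape {T : Filling} {x y : ℕ} :
    (x, y) ∈ T.transpose.shape ↔ (y, x) ∈ T.shape := YoungDiagram.mem_transpose

theorem ext_mem {T T' : Filling} (h1 : ∀ x y, (x, y) ∈ T.shape ↔ (x, y) ∈ T'.shape)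
    (h2 : ∀ x y, (x, y) ∈ T.points ↔ (x, y) ∈ T'.points) : T = T' := by
  refine Filling.ext ?_ ?_
  · ext ⟨x, y⟩
    exact h1 x y
  · ext ⟨x, y⟩
    exact h2 x y

theorem transpose_transpose (T : Filling) : T.transpose.transpose = T :=
  ext_mem (fun _ _ => by rw [mem_transpose_shape, mem_transpose_shape])
    fun _ _ => by rw [mem_transpose_points, mem_transpose_points]

theorem isTreeLike_transpose {T : Filling} : T.transpose.IsTreeLike ↔ T.IsTreeLike := by
  rw [isTreeLike_iff, isTreeLike_iff]
  simp only [HasAbove, HasLeft, mem_transpose_points, mem_transpose_shape]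
  constructor
  · rintro ⟨h1, h2, h3, h4⟩
    exact ⟨h1, fun x y h h' => (xor_comm _ _).mp (h2 y x h (by simpa [and_comm] using h')), h4, h3⟩
  · rintro ⟨h1, h2, h3, h4⟩
    exact ⟨h1, fun x y h h' => (xor_comm _ _).mp (h2 y x h (by simpa [and_comm] using h')), h4, h3⟩

/-- Insertion of a line and of a point, without adding a ribbon. -/
def plainInsert (T : Filling) (e : Edge) : Filling where
  shape := insertLine T.shape e
  points := insert (newCell T.shape e) (T.points.image (shift T.shape e))
  points_subset := by
    intro p hp
    rcases Finset.mem_insert.1 hp with rfl | hp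
    · exact Finset.mem_union_right _ (newCell_mem_newLine _ _)
    · exact Finset.mem_union_left _ (Finset.image_subset_image T.points_subset hp)

theorem mem_plainInsert_below {T : Filling} {c x y : ℕ} :
    (x, y) ∈ (T.plainInsert (.below c)).points ↔
      (x < T.shape.colLen c ∧ (x, y) ∈ T.points) ∨
      (T.shape.colLen c < x ∧ (x - 1, y) ∈ T.points) ∨ (x = T.shape.colLen c ∧ y = c) := by
  simp only [plainInsert, newCell, Finset.mem_insert, Prod.mk.injEq, Finset.mem_image, shift,
    Prod.exists]
  constructor
  · rintro (h | ⟨a, b, h, hx, rfl⟩)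
    · exact Or.inr (Or.inr h)
    · split_ifs at hx with h'
      · subst hx
        exact Or.inl ⟨h', h⟩
      · subst hx
        exact Or.inr (Or.inl ⟨by omega, h⟩)
  · rintro (⟨h1, h2⟩ | ⟨h1, h2⟩ | h)
    · exact Or.inr ⟨x, y, h2, if_pos h1, rfl⟩
    · refine Or.inr ⟨x - 1, y, h2, ?_, rfl⟩
      rw [if_neg (by omega)]
      omega
    · exact Or.inl h

/-- Reduces column insertions to row insertions. Special points and ribbons are not symmetric under
reflection, which is why they are kept out of `plainInsert`. -/
theorem transpose_plainInsert (T : Filling) (e : Edge) :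
    (T.plainInsert e).transpose = T.transpose.plainInsert e.transpose := by
  refine ext_mem (fun x y => ?_) fun x y => ?_
  · rw [mem_transpose_shape]
    cases e with
    | below c =>
      simp only [plainInsert, Edge.transpose, mem_insertLine_below, mem_insertLine_right,
        transpose, Prod.swap_prod_mk, YoungDiagram.rowLen_transpose, YoungDiagram.mem_transpose]
    | right r =>
      simp only [plainInsert, Edge.transpose, mem_insertLine_below, mem_insertLine_right,
        transpose, Prod.swap_prod_mk, YoungDiagram.colLen_transpose, YoungDiagram.mem_transpose]
  · rw [mem_transpose_points]
    cases e with
    | below c =>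
      simp only [plainInsert, Edge.transpose, Finset.mem_insert, Finset.mem_image, Prod.exists,
        newCell, shift, Prod.mk.injEq, transpose,
        YoungDiagram.rowLen_transpose, Finset.mem_map_equiv, Equiv.prodComm_symm,
        Equiv.prodComm_apply, Prod.swap_prod_mk]
      rw [exists_comm]
      simp only [and_comm]
    | right r =>
      simp only [plainInsert, Edge.transpose, Finset.mem_insert, Finset.mem_image, Prod.exists,
        newCell, shift, Prod.mk.injEq, transpose,
        YoungDiagram.colLen_transpose, Finset.mem_map_equiv, Equiv.prodComm_symm,
        Equiv.prodComm_apply, Prod.swap_prod_mk]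
      rw [exists_comm]
      simp only [and_comm]

theorem newCell_transpose (T : Filling) (e : Edge) :
    newCell T.transpose.shape e.transpose = (newCell T.shape e).swap := by
  cases e <;> simp [newCell, Edge.transpose, transpose]

theorem isBorder_transpose {T : Filling} {e : Edge} :
    e.transpose.IsBorder T.transpose.shape ↔ e.IsBorder T.shape := by
  cases e <;> simp [Edge.IsBorder, Edge.transpose, transpose]

theorem mem_plainInsert_right {T : Filling} {r x y : ℕ} :
    (x, y) ∈ (T.plainInsert (.right r)).points ↔
      (y < T.shape.rowLen r ∧ (x, y) ∈ T.points) ∨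
      (T.shape.rowLen r < y ∧ (x, y - 1) ∈ T.points) ∨ (y = T.shape.rowLen r ∧ x = r) := by
  rw [← mem_transpose_points, transpose_plainInsert, Edge.transpose, mem_plainInsert_below]
  simp only [mem_transpose_points]
  simp [transpose]

section Below

variable {T : Filling} {c : ℕ}

theorem hasAbove_newCell_below (h : ∃ x, (x, c) ∈ T.points) :
    (T.plainInsert (.below c)).HasAbove (T.shape.colLen c) c := by
  obtain ⟨x, hx⟩ := h
  have := (mem_iff_col _ _).1 (mem_shape hx)
  exact ⟨x, this, mem_plainInsert_below.2 (Or.inl ⟨this, hx⟩)⟩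

theorem not_hasLeft_newCell_below :
    ¬ (T.plainInsert (.below c)).HasLeft (T.shape.colLen c) c := by
  rintro ⟨y, hy, h⟩
  rw [mem_plainInsert_below] at h
  omega

theorem hasAbove_plainInsert_below_of_lt {x y : ℕ} (h : x < T.shape.colLen c) :
    (T.plainInsert (.below c)).HasAbove x y ↔ T.HasAbove x y := by
  refine exists_congr fun x' => and_congr_right fun hx' => ?_
  rw [mem_plainInsert_below]
  constructor
  · rintro (h | h | h)
    · exact h.2
    · omega
    · omega
  · exact fun h' => Or.inl ⟨by omega, h'⟩

theorem hasLeft_plainInsert_below_of_lt {x y : ℕ} (h : x < T.shape.colLen c) :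
    (T.plainInsert (.below c)).HasLeft x y ↔ T.HasLeft x y := by
  refine exists_congr fun x' => and_congr_right fun hx' => ?_
  rw [mem_plainInsert_below]
  constructor
  · rintro (h | h | h)
    · exact h.2
    · omega
    · omega
  · exact fun h' => Or.inl ⟨by omega, h'⟩

theorem hasLeft_plainInsert_below_of_gt {x y : ℕ} (h : T.shape.colLen c ≤ x) :
    (T.plainInsert (.below c)).HasLeft (x + 1) y ↔ T.HasLeft x y := by
  refine exists_congr fun x' => and_congr_right fun hx' => ?_
  rw [mem_plainInsert_below]
  constructor
  · rintro (h | h | h)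
    · omega
    · exact h.2
    · omega
  · exact fun h' => Or.inr (Or.inl ⟨by omega, h'⟩)

/-- The new point is below every cell of its own column, so it becomes a point above no old point.
-/
theorem hasAbove_plainInsert_below_of_gt {x y : ℕ} (h : T.shape.colLen c ≤ x)
    (hxy : (x, y) ∈ T.points) :
    (T.plainInsert (.below c)).HasAbove (x + 1) y ↔ T.HasAbove x y := by
  have hyc : y ≠ c := by
    rintro rfl
    have := (mem_iff_col _ _).1 (mem_shape hxy)
    omega
  constructor
  · rintro ⟨x', hx', h'⟩
    rw [mem_plainInsert_below] at h'
    rcases h' with h' | h' | h'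
    · exact ⟨x', by omega, h'.2⟩
    · exact ⟨x' - 1, by omega, h'.2⟩
    · omega
  · rintro ⟨x', hx', h'⟩
    by_cases hlt : x' < T.shape.colLen c
    · exact ⟨x', by omega, mem_plainInsert_below.2 (Or.inl ⟨hlt, h'⟩)⟩
    · exact ⟨x' + 1, by omega, mem_plainInsert_below.2 (Or.inr (Or.inl ⟨by omega, h'⟩))⟩

/-- Old points keep their relative positions. The new point is alone in its row and has a point
above it because column `c` is not empty. -/
theorem isTreeLike_plainInsert_below (h : ∃ x, (x, c) ∈ T.points) :
    (T.plainInsert (.below c)).IsTreeLike ↔ T.IsTreeLike := by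
  have hpos : 0 < T.shape.colLen c := by
    obtain ⟨x, hx⟩ := h
    have := (mem_iff_col _ _).1 (mem_shape hx)
    omega
  have hlt : ∀ {x y}, x < T.shape.colLen c →
      ((x, y) ∈ (T.plainInsert (.below c)).points ↔ (x, y) ∈ T.points) := by
    intro x y hx
    rw [mem_plainInsert_below]
    constructor
    · rintro (h | h | h)
      · exact h.2
      · omega
      · omega
    · exact fun h' => Or.inl ⟨by omega, h'⟩
  have hgt : ∀ {x y}, T.shape.colLen c ≤ x →
      ((x + 1, y) ∈ (T.plainInsert (.below c)).points ↔ (x, y) ∈ T.points) := by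
    intro x y hx
    rw [mem_plainInsert_below]
    constructor
    · rintro (h | h | h)
      · omega
      · exact h.2
      · omega
    · exact fun h' => Or.inr (Or.inl ⟨by omega, h'⟩)
  rw [isTreeLike_iff, isTreeLike_iff, hlt hpos]
  refine and_congr_right fun _ => and_congr ?_ (and_congr ?_ ?_)
  · constructor
    · intro H x y hxy h0
      by_cases hx : x < T.shape.colLen c
      · rw [← hasAbove_plainInsert_below_of_lt hx, ← hasLeft_plainInsert_below_of_lt hx]
        exact H x y ((hlt hx).2 hxy) h0
      · rw [← hasAbove_plainInsert_below_of_gt (c := c) (by omega) hxy,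
          ← hasLeft_plainInsert_below_of_gt (c := c) (by omega)]
        exact H _ y ((hgt (by omega)).2 hxy) (by simp)
    · intro H x y hxy h0
      rcases lt_trichotomy x (T.shape.colLen c) with hx | hx | hx
      · rw [hasAbove_plainInsert_below_of_lt hx, hasLeft_plainInsert_below_of_lt hx]
        exact H x y ((hlt hx).1 hxy) h0
      · obtain rfl : y = c := by
          rw [mem_plainInsert_below] at hxy
          omega
        subst hx
        exact Or.inl ⟨hasAbove_newCell_below h, not_hasLeft_newCell_below⟩
      · obtain ⟨x, rfl⟩ : ∃ x', x = x' + 1 := ⟨x - 1, by omega⟩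
        have hxy' := (hgt (by omega)).1 hxy
        rw [hasAbove_plainInsert_below_of_gt (by omega) hxy',
          hasLeft_plainInsert_below_of_gt (by omega)]
        exact H x y hxy' (by simp; omega)
  · simp only [plainInsert, mem_insertLine_below]
    constructor
    · intro H x hx
      by_cases hx' : x < T.shape.colLen c
      · obtain ⟨y, hy⟩ := H x (Or.inl ⟨hx', hx⟩)
        exact ⟨y, (hlt hx').1 hy⟩
      · obtain ⟨y, hy⟩ := H (x + 1) (Or.inr (Or.inl ⟨by omega, hx⟩))
        exact ⟨y, (hgt (by omega)).1 hy⟩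
    · rintro H x (hx | hx | hx)
      · obtain ⟨y, hy⟩ := H x hx.2
        exact ⟨y, (hlt hx.1).2 hy⟩
      · obtain ⟨y, hy⟩ := H (x - 1) hx.2
        have := (hgt (x := x - 1) (by omega)).2 hy
        rw [Nat.sub_add_cancel (by omega)] at this
        exact ⟨y, this⟩
      · exact ⟨c, mem_plainInsert_below.2 (Or.inr (Or.inr ⟨hx.1, rfl⟩))⟩
  · simp only [plainInsert, mem_insertLine_below]
    constructor
    · intro H y hy
      obtain ⟨x, hx⟩ := H y (Or.inl ⟨hpos, hy⟩)
      rcases mem_plainInsert_below.1 hx with h' | h' | h'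
      · exact ⟨x, h'.2⟩
      · exact ⟨x - 1, h'.2⟩
      · obtain rfl := h'.2
        exact h
    · rintro H y (hy | hy | hy)
      · obtain ⟨x, hx⟩ := H y hy.2
        by_cases hx' : x < T.shape.colLen c
        · exact ⟨x, (hlt hx').2 hx⟩
        · exact ⟨x + 1, (hgt (by omega)).2 hx⟩
      · omega
      · omega

theorem mem_shape_iff_plainInsert_below {x y : ℕ} : (x, y) ∈ T.shape ↔
    ((if x < T.shape.colLen c then x else x + 1), y) ∈ (T.plainInsert (.below c)).shape := by
  simp only [plainInsert, mem_insertLine_below]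
  split_ifs with h
  · constructor
    · exact fun h' => Or.inl ⟨h, h'⟩
    · rintro (h' | h' | h')
      · exact h'.2
      · omega
      · omega
  · constructor
    · exact fun h' => Or.inr (Or.inl ⟨by omega, h'⟩)
    · rintro (h' | h' | h')
      · omega
      · exact h'.2
      · omega

theorem mem_points_iff_plainInsert_below {x y : ℕ} : (x, y) ∈ T.points ↔
    ((if x < T.shape.colLen c then x else x + 1), y) ∈ (T.plainInsert (.below c)).points := by
  rw [mem_plainInsert_below]
  split_ifs with h
  · constructor
    · exact fun h' => Or.inl ⟨h, h'⟩
    · rintro (h' | h' | h')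
      · exact h'.2
      · omega
      · omega
  · constructor
    · exact fun h' => Or.inr (Or.inl ⟨by omega, h'⟩)
    · rintro (h' | h' | h')
      · omega
      · exact h'.2
      · omega

theorem plainInsert_below_injective {T' : Filling} {c' : ℕ}
    (h : T.plainInsert (.below c) = T'.plainInsert (.below c'))
    (hn : newCell T.shape (.below c) = newCell T'.shape (.below c')) : T = T' ∧ c = c' := by
  obtain ⟨h1, rfl⟩ := Prod.mk.inj hn
  refine ⟨ext_mem (fun x y => ?_) fun x y => ?_, rfl⟩
  · rw [mem_shape_iff_plainInsert_below, h, h1, ← mem_shape_iff_plainInsert_below]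
  · rw [mem_points_iff_plainInsert_below, h, h1, ← mem_points_iff_plainInsert_below]

theorem isOccupiedCorner_newCell_below :
    (T.plainInsert (.below c)).IsOccupiedCorner (newCell T.shape (.below c)) := by
  refine ⟨Finset.mem_insert_self _ _, mem_shape (Finset.mem_insert_self _ _), ?_, ?_⟩
  all_goals
    simp only [plainInsert, mem_insertLine_below, newCell]
    simp only [mem_iff_col]
    omega

end Below

/-- Every tree-like tableau with an occupied corner having a point above it arises from the
insertion of a row. -/
theorem exists_plainInsert_below_eq {F : Filling} {a b : ℕ} (hF : F.IsTreeLike)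
    (hp : F.IsOccupiedCorner (a, b)) (hab : F.HasAbove a b) :
    ∃ T : Filling, ∃ c, T.IsTreeLike ∧ Edge.IsBorder T.shape (.below c) ∧
      newCell T.shape (.below c) = (a, b) ∧ T.plainInsert (.below c) = F := by
  obtain ⟨hp0, hp1, hp2, hp3⟩ := hp
  have ha0 : 0 < a := by
    obtain ⟨x, hx, -⟩ := hab
    omega
  -- The corner is the only point of its row: nothing lies to its right, and a point above it
  -- excludes one to its left. The row can thus be deleted.
  have hrow : ∀ y, (a, y) ∈ F.points → y = b := by
    intro y hy
    have hle : y ≤ b := by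
      by_contra! hlt
      exact hp3 (mem_of_le (mem_shape hy) le_rfl hlt)
    have hx := (isTreeLike_iff.1 hF).2.1 a b hp0 (by simp; omega)
    have hnl : ¬ F.HasLeft a b := by
      rcases hx with h | h
      · exact h.2
      · exact absurd hab h.2
    by_contra hne
    exact hnl ⟨y, by omega, hy⟩
  -- `f` skips row `a`, so pulling back along it deletes that row.
  let f : ℕ × ℕ → ℕ × ℕ := fun q => ((if q.1 < a then q.1 else q.1 + 1), q.2)
  have hf : Function.Injective f := by
    rintro ⟨x, y⟩ ⟨x', y'⟩ h
    simp only [f, Prod.mk.injEq] at h ⊢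
    refine ⟨?_, h.2⟩
    have := h.1
    split_ifs at this <;> omega
  let μ : YoungDiagram :=
    { cells := F.shape.cells.preimage f hf.injOn
      isLowerSet := by
        rintro ⟨x, y⟩ ⟨x', y'⟩ hle h
        obtain ⟨h1, h2⟩ : x' ≤ x ∧ y' ≤ y := hle
        simp only [Finset.coe_preimage, Set.mem_preimage, f, Finset.mem_coe,
          YoungDiagram.mem_cells] at h ⊢
        refine mem_of_le h ?_ h2
        dsimp only
        split_ifs <;> omega }
  have hμ : ∀ {x y}, (x, y) ∈ μ ↔ ((if x < a then x else x + 1), y) ∈ F.shape := by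
    intro x y
    rw [← YoungDiagram.mem_cells]
    simp [μ, f]
  let T : Filling := ⟨μ, F.points.preimage f hf.injOn, by
    intro q hq
    rw [Finset.mem_preimage] at hq
    simp only [μ, Finset.mem_preimage]
    exact F.points_subset hq⟩
  have hT : ∀ {x y}, (x, y) ∈ T.points ↔ ((if x < a then x else x + 1), y) ∈ F.points := by
    intro x y
    simp [T, f]
  have hcol : T.shape.colLen b = a := by
    rw [colLen_eq_iff]
    intro x
    change (x, b) ∈ μ ↔ _
    rw [hμ]
    split_ifs with h
    · simp only [h, iff_true]
      exact mem_of_le hp1 h.le le_rfl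
    · simp only [h, iff_false]
      exact fun h' => hp2 (mem_of_le h' (by simp; omega) le_rfl)
  have heq : T.plainInsert (.below b) = F := by
    refine ext_mem (fun x y => ?_) fun x y => ?_
    · simp only [plainInsert, mem_insertLine_below, hcol]
      rcases lt_trichotomy x a with h | h | h
      · change ((x < a ∧ (x, y) ∈ μ) ∨ (a < x ∧ (x - 1, y) ∈ μ) ∨ _) ↔ _
        rw [hμ, if_pos h]
        simp only [h, true_and]
        constructor
        · rintro (h' | h' | h')
          · exact h'
          · omega
          · omega
        · exact Or.inl
      · subst h
        constructor
        · rintro (h' | h' | h')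
          · omega
          · omega
          · exact mem_of_le hp1 le_rfl h'.2
        · refine fun h' => Or.inr (Or.inr ⟨rfl, ?_⟩)
          by_contra! hlt
          exact hp3 (mem_of_le h' le_rfl hlt)
      · change ((x < a ∧ (x, y) ∈ μ) ∨ (a < x ∧ (x - 1, y) ∈ μ) ∨ _) ↔ _
        rw [@hμ (x - 1), if_neg (by omega), Nat.sub_add_cancel (by omega)]
        constructor
        · rintro (h' | h' | h')
          · omega
          · exact h'.2
          · omega
        · exact fun h' => Or.inr (Or.inl ⟨h, h'⟩)
    · rw [mem_plainInsert_below, hcol]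
      rcases lt_trichotomy x a with h | h | h
      · rw [hT, if_pos h]
        constructor
        · rintro (h' | h' | h')
          · exact h'.2
          · omega
          · omega
        · exact fun h' => Or.inl ⟨h, h'⟩
      · subst h
        constructor
        · rintro (h' | h' | h')
          · omega
          · omega
          · rwa [h'.2]
        · exact fun h' => Or.inr (Or.inr ⟨rfl, hrow y h'⟩)
      · rw [@hT (x - 1), if_neg (by omega), Nat.sub_add_cancel (by omega)]
        constructor
        · rintro (h' | h' | h')
          · omega
          · exact h'.2
          · omega
        · exact fun h' => Or.inr (Or.inl ⟨h, h'⟩)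
  have hex : ∃ x, (x, b) ∈ T.points := by
    obtain ⟨x, hx, h⟩ := hab
    exact ⟨x, hT.2 (by rwa [if_pos hx])⟩
  refine ⟨T, b, ?_, ?_, ?_, heq⟩
  · rw [← isTreeLike_plainInsert_below hex, heq]
    exact hF
  · obtain ⟨x, hx⟩ := hex
    exact (mem_iff_row _ _).1 (mem_of_le (mem_shape hx) (Nat.zero_le _) le_rfl)
  · simp [newCell, hcol]

end Filling

end TreeLike

/-! ### Insertion of a point is bijective. -/

namespace TreeLike

namespace Filling

variable {T : Filling} {e : Edge}

theorem isOccupiedCorner_transpose {a b : ℕ} :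
    T.transpose.IsOccupiedCorner (b, a) ↔ T.IsOccupiedCorner (a, b) := by
  simp only [IsOccupiedCorner, IsCorner, mem_transpose_points, mem_transpose_shape]
  tauto

theorem hasAbove_transpose {a b : ℕ} : T.transpose.HasAbove b a ↔ T.HasLeft a b := by
  simp only [HasAbove, HasLeft, mem_transpose_points]

theorem IsTreeLike.exists_mem_col (hT : T.IsTreeLike) {c : ℕ}
    (he : Edge.IsBorder T.shape (.below c)) : ∃ x, (x, c) ∈ T.points :=
  (isTreeLike_iff.1 hT).2.2.2 c ((mem_iff_row _ _).2 he)

theorem IsTreeLike.plainInsert (hT : T.IsTreeLike) (he : e.IsBorder T.shape) :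
    (T.plainInsert e).IsTreeLike := by
  cases e with
  | below c => exact (isTreeLike_plainInsert_below (hT.exists_mem_col he)).2 hT
  | right r =>
    rw [← isTreeLike_transpose, transpose_plainInsert]
    have hT' := isTreeLike_transpose.2 hT
    exact (isTreeLike_plainInsert_below (hT'.exists_mem_col (isBorder_transpose.2 he))).2 hT'

theorem isOccupiedCorner_newCell (T : Filling) (e : Edge) :
    (T.plainInsert e).IsOccupiedCorner (newCell T.shape e) := by
  cases e with
  | below c => exact isOccupiedCorner_newCell_below
  | right r =>
    rw [newCell, ← isOccupiedCorner_transpose, transpose_plainInsert]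
    have := isOccupiedCorner_newCell_below (T := T.transpose) (c := r)
    simpa [Edge.transpose, newCell, transpose] using this

/-- Tells a row insertion from a column insertion by looking only at the result. -/
theorem hasAbove_newCell (hT : T.IsTreeLike) (he : e.IsBorder T.shape) :
    (T.plainInsert e).HasAbove (newCell T.shape e).1 (newCell T.shape e).2 ↔
      ∃ c, e = .below c := by
  cases e with
  | below c =>
    exact ⟨fun _ => ⟨c, rfl⟩, fun _ => hasAbove_newCell_below (hT.exists_mem_col he)⟩
  | right r =>
    simp only [reduceCtorEq, exists_false, iff_false]
    have := not_hasLeft_newCell_below (T := T.transpose) (c := r)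
    rw [← hasAbove_transpose, transpose_plainInsert, transpose_transpose] at this
    simpa [Edge.transpose, newCell, transpose] using this

theorem plainInsert_injective {T' : Filling} {e' : Edge} (hT : T.IsTreeLike)
    (he : e.IsBorder T.shape) (hT' : T'.IsTreeLike) (he' : e'.IsBorder T'.shape)
    (h : T.plainInsert e = T'.plainInsert e') (hn : newCell T.shape e = newCell T'.shape e') :
    T = T' ∧ e = e' := by
  have key := hasAbove_newCell hT he
  rw [h, hn, hasAbove_newCell hT' he'] at key
  cases e with
  | below c =>
    obtain ⟨c', rfl⟩ := key.2 ⟨c, rfl⟩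
    obtain ⟨rfl, rfl⟩ := plainInsert_below_injective h hn
    exact ⟨rfl, rfl⟩
  | right r =>
    cases e' with
    | below c' => simp at key
    | right r' =>
      have h2 := congrArg transpose h
      rw [transpose_plainInsert, transpose_plainInsert] at h2
      have hn2 : newCell T.transpose.shape (Edge.right r).transpose =
          newCell T'.transpose.shape (Edge.right r').transpose := by
        rw [newCell_transpose, newCell_transpose, hn]
      obtain ⟨h3, rfl⟩ := plainInsert_below_injective h2 hn2
      rw [← transpose_transpose T, h3, transpose_transpose]
      exact ⟨rfl, rfl⟩

theorem exists_plainInsert_eq {F : Filling} {p : ℕ × ℕ} (hF : F.IsTreeLike)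
    (hp : F.IsOccupiedCorner p) (h0 : p ≠ (0, 0)) :
    ∃ T : Filling, ∃ e, T.IsTreeLike ∧ e.IsBorder T.shape ∧ newCell T.shape e = p ∧
      T.plainInsert e = F := by
  obtain ⟨a, b⟩ := p
  rcases (isTreeLike_iff.1 hF).2.1 a b hp.1 h0 with ⟨h, -⟩ | ⟨h, -⟩
  · obtain ⟨T, c, h1⟩ := exists_plainInsert_below_eq hF hp h
    exact ⟨T, _, h1⟩
  · obtain ⟨T, c, h1, h2, h3, h4⟩ := exists_plainInsert_below_eq (isTreeLike_transpose.2 hF)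
      (isOccupiedCorner_transpose.2 hp) (hasAbove_transpose.2 h)
    refine ⟨T.transpose, (Edge.below c).transpose, isTreeLike_transpose.2 h1,
      isBorder_transpose.2 h2, ?_, ?_⟩
    · rw [newCell_transpose, h3, Prod.swap_prod_mk]
    · rw [← transpose_plainInsert, h4, transpose_transpose]

theorem colLen_pos {c : ℕ} (he : c < T.shape.rowLen 0) :
    0 < T.shape.colLen c := by
  rwa [← mem_iff_col, mem_iff_row]

theorem rowLen_pos {r : ℕ} (he : r < T.shape.colLen 0) :
    0 < T.shape.rowLen r := by
  rwa [← mem_iff_row, mem_iff_col]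

theorem shift_zero (he : e.IsBorder T.shape) :
    shift T.shape e (0, 0) = (0, 0) := by
  cases e with
  | below c => simp [shift, colLen_pos he]
  | right r => simp [shift, rowLen_pos he]

theorem shift_injective (μ : YoungDiagram) (e : Edge) : Function.Injective (shift μ e) := by
  rintro ⟨x, y⟩ ⟨x', y'⟩ h
  cases e
  all_goals
    simp only [shift, Prod.mk.injEq] at h ⊢
    obtain ⟨h1, h2⟩ := h
    constructor
    all_goals first | exact h1 | exact h2 | (split_ifs at h1 <;> omega) | (split_ifs at h2 <;> omega)

theorem shift_ne_newCell (μ : YoungDiagram) (e : Edge) (q : ℕ × ℕ) : shift μ e q ≠ newCell μ e := by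
  obtain ⟨x, y⟩ := q
  intro h
  cases e
  all_goals
    simp only [shift, newCell, Prod.mk.injEq] at h
    obtain ⟨h1, h2⟩ := h
    first | (split_ifs at h1 <;> omega) | (split_ifs at h2 <;> omega)

theorem card_plainInsert (T : Filling) (e : Edge) :
    (T.plainInsert e).points.card = T.points.card + 1 := by
  rw [Filling.plainInsert, Finset.card_insert_of_notMem,
    Finset.card_image_of_injective _ (shift_injective _ _)]
  intro h
  obtain ⟨q, -, h⟩ := Finset.mem_image.1 h
  exact shift_ne_newCell _ _ _ h

theorem colLen_le_of_le {μ : YoungDiagram} {c c' : ℕ} (h : c ≤ c') : μ.colLen c' ≤ μ.colLen c :=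
  μ.colLen_anti _ _ h

/-- Columns to the right of `c` end no lower than column `c`, hence strictly above or at the place
where the row is inserted, and the row does not reach them. -/
theorem isBottom_plainInsert_below {c x y : ℕ} (h : c < y) :
    (T.plainInsert (.below c)).IsBottom (x, y) ↔ T.IsBottom (x, y) := by
  have hle := colLen_le_of_le (μ := T.shape) h.le
  have key : ∀ x, (x, y) ∈ (T.plainInsert (.below c)).shape ↔ (x, y) ∈ T.shape := by
    intro x
    simp only [Filling.plainInsert, mem_insertLine_below]
    simp only [mem_iff_col]
    omega
  refine and_congr ?_ (not_congr (key _))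
  rw [mem_plainInsert_below]
  constructor
  · rintro (h' | h' | h')
    · exact h'.2
    · have := (mem_iff_col _ _).1 (mem_shape h'.2)
      omega
    · omega
  · refine fun h' => Or.inl ⟨?_, h'⟩
    have := (mem_iff_col _ _).1 (mem_shape h')
    omega

theorem isBottom_plainInsert_right {r x y : ℕ} (h : T.shape.rowLen r ≤ y) :
    (T.plainInsert (.right r)).IsBottom (x, y + 1) ↔ T.IsBottom (x, y) := by
  refine and_congr ?_ (not_congr ?_)
  · rw [mem_plainInsert_right]
    constructor
    · rintro (h' | h' | h')
      · omega
      · exact h'.2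
      · omega
    · exact fun h' => Or.inr (Or.inl ⟨by omega, h'⟩)
  · simp only [Filling.plainInsert, mem_insertLine_right, Nat.add_sub_cancel]
    constructor
    · rintro (h' | h' | h')
      · omega
      · exact h'.2
      · omega
    · exact fun h' => Or.inr (Or.inl ⟨by omega, h'⟩)

end Filling

theorem Edge.index_below_le_below {μ : YoungDiagram} {c c' : ℕ} :
    (Edge.below c').index μ ≤ (Edge.below c).index μ ↔ c' ≤ c := by
  simp only [Edge.index]
  have h1 := Filling.colLen_le_of_le (μ := μ) (Nat.zero_le c)
  have h2 := Filling.colLen_le_of_le (μ := μ) (Nat.zero_le c')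
  rcases lt_trichotomy c c' with h | rfl | h
  · have := Filling.colLen_le_of_le (μ := μ) h.le
    omega
  · simp
  · have := Filling.colLen_le_of_le (μ := μ) h.le
    omega

theorem Edge.index_below_lt_right {μ : YoungDiagram} {c r : ℕ} (hr : r < μ.colLen 0)
    (h : c < μ.rowLen r) : (Edge.below c).index μ < (Edge.right r).index μ := by
  simp only [Edge.index]
  have h1 := Filling.colLen_le_of_le (μ := μ) (Nat.zero_le c)
  rw [← mem_iff_row, mem_iff_col] at h
  have := h
  rw [← mem_iff_col, mem_iff_row] at this
  omega

theorem Edge.index_right_lt_below {μ : YoungDiagram} {c r : ℕ} (hr : r < μ.colLen 0)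
    (h : μ.rowLen r ≤ c) : (Edge.right r).index μ < (Edge.below c).index μ := by
  simp only [Edge.index]
  have h1 := Filling.colLen_le_of_le (μ := μ) (Nat.zero_le c)
  have h2 : μ.colLen c ≤ r := by
    by_contra! h3
    rw [← mem_iff_col, mem_iff_row] at h3
    omega
  omega

theorem Edge.index_right_lt_right {μ : YoungDiagram} {r r' : ℕ} (hr : r' < μ.colLen 0)
    (h : r < r') : (Edge.right r').index μ < (Edge.right r).index μ := by
  simp only [Edge.index]
  have h1 := μ.rowLen_anti _ _ h.le
  omega

namespace Filling

variable {T : Filling} {e : Edge}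

/-- The new point is a bottom point, and the index comparison decides whether it lies to the right
of the old special point or in its column, or else to its left. -/
theorem specialPoint_plainInsert (hT : T.IsTreeLike) (he : e.IsBorder T.shape) :
    specialPoint (T.plainInsert e) =
      if sp T ≤ e.index T.shape then newCell T.shape e else shift T.shape e (specialPoint T) := by
  have hs := hT.isBottom_specialPoint
  have hcorner := (isOccupiedCorner_newCell T e).isBottom
  cases e with
  | below c =>
    have hiff : sp T ≤ (Edge.below c).index T.shape ↔ (specialPoint T).2 ≤ c :=
      Edge.index_below_le_below
    simp only [hiff]
    split_ifs with h
    · refine specialPoint_eq hcorner fun ⟨x, y⟩ hq => ?_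
      by_contra! hlt
      have := ((isBottom_plainInsert_below hlt).1 hq).le_specialPoint
      simp only [newCell] at hlt this
      omega
    · push Not at h
      have hx : (specialPoint T).1 < T.shape.colLen (specialPoint T).2 :=
        (mem_iff_col _ _).1 (mem_shape hs.1)
      have := colLen_le_of_le (μ := T.shape) h.le
      have hsh : shift T.shape (.below c) (specialPoint T) = specialPoint T := by
        generalize specialPoint T = s at *
        obtain ⟨a, b⟩ := s
        simp only [shift, Prod.mk.injEq, and_true, ite_eq_left_iff]
        dsimp only at hx this
        omega
      rw [hsh]
      refine specialPoint_eq ((isBottom_plainInsert_below h).2 hs) fun ⟨x, y⟩ hq => ?_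
      by_contra! hlt
      have := ((isBottom_plainInsert_below (h.trans hlt)).1 hq).le_specialPoint
      dsimp only at this hlt
      omega
  | right r =>
    have hiff : sp T ≤ (Edge.right r).index T.shape ↔ (specialPoint T).2 < T.shape.rowLen r := by
      rcases lt_or_ge (specialPoint T).2 (T.shape.rowLen r) with h | h
      · exact iff_of_true (Edge.index_below_lt_right he h).le h
      · exact iff_of_false (Edge.index_right_lt_below he h).not_ge h.not_gt
    simp only [hiff]
    split_ifs with h
    · refine specialPoint_eq hcorner fun ⟨x, y⟩ hq => ?_
      by_contra! hlt
      simp only [newCell] at hlt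
      obtain ⟨y, rfl⟩ : ∃ y', y = y' + 1 := ⟨y - 1, by omega⟩
      have := ((isBottom_plainInsert_right (by omega)).1 hq).le_specialPoint
      dsimp only at this
      omega
    · push Not at h
      have hsh : shift T.shape (.right r) (specialPoint T) =
          ((specialPoint T).1, (specialPoint T).2 + 1) := by
        simp only [shift, if_neg h.not_gt]
      rw [hsh]
      refine specialPoint_eq ((isBottom_plainInsert_right h).2 hs) fun ⟨x, y⟩ hq => ?_
      by_contra! hlt
      dsimp only at hlt
      obtain ⟨y, rfl⟩ : ∃ y', y = y' + 1 := ⟨y - 1, by omega⟩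
      have := ((isBottom_plainInsert_right (by omega)).1 hq).le_specialPoint
      dsimp only at this
      omega

/-- The case distinction of `insertShape` disappears: when no ribbon is prescribed, the special
point of the intermediate filling is the new point and the ribbon is empty. -/
theorem insertPoint_eq_close (hT : T.IsTreeLike) (he : e.IsBorder T.shape) :
    insertPoint T e = (T.plainInsert e).close (newCell T.shape e) := by
  have hF := hT.plainInsert he
  have hp := isOccupiedCorner_newCell T e
  have hs := specialPoint_plainInsert hT he
  refine Filling.ext ?_ rfl
  change insertShape T e = addRibbon (insertLine T.shape e) _ _
  unfold insertShape
  rw [hs]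
  split_ifs with h
  · ext ⟨x, y⟩
    have := mem_close hF hp (x := x) (y := y)
    rw [hs, if_pos h] at this
    rw [YoungDiagram.mem_cells, YoungDiagram.mem_cells,
      mem_addRibbon (ν := insertLine T.shape e) hp.2.1 hp.2.1]
    constructor
    · exact Or.inl
    · rintro (h | h)
      · exact h
      · omega
  · rfl

theorem IsTreeLike.insertPoint (hT : T.IsTreeLike) (he : e.IsBorder T.shape) :
    (insertPoint T e).IsTreeLike := by
  rw [insertPoint_eq_close hT he]
  exact close_isTreeLike (hT.plainInsert he) (isOccupiedCorner_newCell T e)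

theorem card_insertPoint (T : Filling) (e : Edge) :
    (TreeLike.insertPoint T e).points.card = T.points.card + 1 := card_plainInsert T e

theorem insertPoint_injective {T' : Filling} {e' : Edge} (hT : T.IsTreeLike)
    (he : e.IsBorder T.shape) (hT' : T'.IsTreeLike) (he' : e'.IsBorder T'.shape)
    (h : TreeLike.insertPoint T e = TreeLike.insertPoint T' e') : T = T' ∧ e = e' := by
  rw [insertPoint_eq_close hT he, insertPoint_eq_close hT' he'] at h
  obtain ⟨h1, h2⟩ := close_injective (hT.plainInsert he) (isOccupiedCorner_newCell T e)
    (hT'.plainInsert he') (isOccupiedCorner_newCell T' e') h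
  exact plainInsert_injective hT he hT' he' h1 h2

/-- If the root were a bottom point there would be only one row, and any second point would be a
bottom point further right. -/
theorem specialPoint_ne_zero (hT : T.IsTreeLike) (hcard : 2 ≤ T.points.card) :
    specialPoint T ≠ (0, 0) := by
  intro h
  have hs := hT.isBottom_specialPoint
  obtain ⟨⟨x, y⟩, hq, hne⟩ := Finset.exists_mem_ne (s := T.points) (by omega) (0, 0)
  have hb : T.IsBottom (x, y) := by
    refine ⟨hq, fun h' => hs.2 ?_⟩
    rw [h]
    exact mem_of_le h' (Nat.succ_le_succ (Nat.zero_le _)) (Nat.zero_le _)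
  have := hb.le_specialPoint
  rw [h] at this hs
  dsimp only at this
  obtain rfl : y = 0 := by omega
  have : x ≠ 0 := by
    rintro rfl
    exact hne rfl
  exact hs.2 (mem_of_le (mem_shape hq) (Nat.one_le_iff_ne_zero.2 this) le_rfl)

theorem exists_insertPoint_eq (hT : T.IsTreeLike) (hcard : 2 ≤ T.points.card) :
    ∃ T' : Filling, ∃ e, T'.IsTreeLike ∧ e.IsBorder T'.shape ∧ TreeLike.insertPoint T' e = T := by
  obtain ⟨F, hF, hp, hc⟩ := exists_close_eq hT
  obtain ⟨T', e, h1, h2, h3, h4⟩ := exists_plainInsert_eq hF hp (specialPoint_ne_zero hT hcard)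
  refine ⟨T', e, h1, h2, ?_⟩
  rw [insertPoint_eq_close h1 h2, h4, h3, hc]

end Filling

end TreeLike

/-! ### Effect of an insertion on corners and border indices. -/

namespace TreeLike

namespace Filling

variable {T : Filling} {e : Edge}

theorem mem_insertPoint (hT : T.IsTreeLike) (he : e.IsBorder T.shape) {x y : ℕ} :
    (x, y) ∈ (TreeLike.insertPoint T e).shape ↔ (x, y) ∈ insertLine T.shape e ∨
      (((specialPoint (T.plainInsert e)).1 < x ∧ x ≤ (newCell T.shape e).1) ∧
        ((newCell T.shape e).2 < y ∧ y ≤ (specialPoint (T.plainInsert e)).2) ∧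
        (x - 1, y - 1) ∈ insertLine T.shape e) := by
  rw [insertPoint_eq_close hT he]
  exact mem_close (hT.plainInsert he) (isOccupiedCorner_newCell T e)

theorem mem_insertPoint_zero_right (hT : T.IsTreeLike) (he : e.IsBorder T.shape) {x : ℕ} :
    (x, 0) ∈ (TreeLike.insertPoint T e).shape ↔ (x, 0) ∈ insertLine T.shape e := by
  rw [mem_insertPoint hT he]
  exact or_iff_left (by omega)

theorem mem_insertPoint_zero_left (hT : T.IsTreeLike) (he : e.IsBorder T.shape) {y : ℕ} :
    (0, y) ∈ (TreeLike.insertPoint T e).shape ↔ (0, y) ∈ insertLine T.shape e := by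
  rw [mem_insertPoint hT he]
  exact or_iff_left (by omega)

theorem colLen_zero_insertPoint_below (hT : T.IsTreeLike) {c : ℕ}
    (he : Edge.IsBorder T.shape (.below c)) :
    (TreeLike.insertPoint T (.below c)).shape.colLen 0 = T.shape.colLen 0 + 1 := by
  have := colLen_le_of_le (μ := T.shape) (Nat.zero_le c)
  rw [colLen_eq_iff]
  intro x
  rw [mem_insertPoint_zero_right hT he, mem_insertLine_below]
  simp only [mem_iff_col]
  omega

theorem colLen_zero_insertPoint_right (hT : T.IsTreeLike) {r : ℕ}
    (he : Edge.IsBorder T.shape (.right r)) :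
    (TreeLike.insertPoint T (.right r)).shape.colLen 0 = T.shape.colLen 0 := by
  have := rowLen_pos he
  rw [colLen_eq_iff]
  intro x
  rw [mem_insertPoint_zero_right hT he, mem_insertLine_right]
  simp only [mem_iff_col]
  omega

theorem rowLen_zero_insertPoint_below (hT : T.IsTreeLike) {c : ℕ}
    (he : Edge.IsBorder T.shape (.below c)) :
    (TreeLike.insertPoint T (.below c)).shape.rowLen 0 = T.shape.rowLen 0 := by
  have := colLen_pos he
  rw [rowLen_eq_iff]
  intro x
  rw [mem_insertPoint_zero_left hT he, mem_insertLine_below]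
  simp only [mem_iff_row]
  omega

theorem rowLen_zero_insertPoint_right (hT : T.IsTreeLike) {r : ℕ}
    (he : Edge.IsBorder T.shape (.right r)) :
    (TreeLike.insertPoint T (.right r)).shape.rowLen 0 = T.shape.rowLen 0 + 1 := by
  have := T.shape.rowLen_anti _ _ (Nat.zero_le r)
  rw [rowLen_eq_iff]
  intro x
  rw [mem_insertPoint_zero_left hT he, mem_insertLine_right]
  simp only [mem_iff_row]
  omega

theorem semiperimeter_insertPoint (hT : T.IsTreeLike) (he : e.IsBorder T.shape) :
    (TreeLike.insertPoint T e).shape.colLen 0 + (TreeLike.insertPoint T e).shape.rowLen 0 =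
      T.shape.colLen 0 + T.shape.rowLen 0 + 1 := by
  cases e with
  | below c =>
    rw [colLen_zero_insertPoint_below hT he, rowLen_zero_insertPoint_below hT he]
    omega
  | right r =>
    rw [colLen_zero_insertPoint_right hT he, rowLen_zero_insertPoint_right hT he]
    omega

theorem colLen_eq_of_notMem {μ : YoungDiagram} {x y : ℕ} (h : (x, y) ∈ μ) (h' : (x + 1, y) ∉ μ) :
    μ.colLen y = x + 1 := by
  rw [mem_iff_col] at h h'
  omega

theorem rowLen_eq_of_notMem {μ : YoungDiagram} {x y : ℕ} (h : (x, y) ∈ μ) (h' : (x, y + 1) ∉ μ) :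
    μ.rowLen x = y + 1 := by
  rw [mem_iff_row] at h h'
  omega

theorem IsBottom.colLen_eq {q : ℕ × ℕ} (h : T.IsBottom q) : T.shape.colLen q.2 = q.1 + 1 :=
  colLen_eq_of_notMem (mem_shape h.1) h.2

theorem specialPoint_insertPoint (hT : T.IsTreeLike) (he : e.IsBorder T.shape) :
    specialPoint (TreeLike.insertPoint T e) = newCell T.shape e := by
  rw [insertPoint_eq_close hT he,
    specialPoint_close (hT.plainInsert he) (isOccupiedCorner_newCell T e)]

theorem sp_insertPoint (hT : T.IsTreeLike) (he : e.IsBorder T.shape) :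
    sp (TreeLike.insertPoint T e) = e.index T.shape := by
  have hcol := (hT.insertPoint he).isBottom_specialPoint.colLen_eq
  rw [sp, ← specialPoint_snd, Edge.index, hcol, specialPoint_insertPoint hT he]
  cases e with
  | below c =>
    rw [colLen_zero_insertPoint_below hT he]
    simp only [newCell, Edge.index]
    omega
  | right r =>
    rw [colLen_zero_insertPoint_right hT he]
    rfl

theorem isCorner_newCell_iff (hT : T.IsTreeLike) (he : e.IsBorder T.shape) :
    IsCorner (TreeLike.insertPoint T e).shape (newCell T.shape e) ↔ sp T ≤ e.index T.shape := by
  rw [insertPoint_eq_close hT he,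
    isCorner_close_iff (hT.plainInsert he) (isOccupiedCorner_newCell T e),
    specialPoint_plainInsert hT he]
  split_ifs with h
  · exact iff_of_true rfl h
  · exact iff_of_false (shift_ne_newCell _ _ _) h

theorem index_newCell (hT : T.IsTreeLike) (he : e.IsBorder T.shape) :
    (Edge.below (newCell T.shape e).2).index (TreeLike.insertPoint T e).shape =
      e.index T.shape := by
  rw [← sp_insertPoint hT he, ← specialPoint_insertPoint hT he]
  rfl

theorem shift_mem_insertPoint (T : Filling) (e : Edge) {q : ℕ × ℕ} (h : q ∈ T.shape) :
    shift T.shape e q ∈ (TreeLike.insertPoint T e).shape :=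
  insertLine_subset T e (Finset.mem_union_left _ (Finset.mem_image_of_mem _ h))

/-- Shifting is strictly increasing in each coordinate, so an old neighbour below or to the right
forces a new one. -/
theorem isCorner_of_isCorner_shift {q : ℕ × ℕ} (hq : q ∈ T.shape)
    (h : IsCorner (TreeLike.insertPoint T e).shape (shift T.shape e q)) : IsCorner T.shape q := by
  obtain ⟨-, h1, h2⟩ := h
  refine ⟨hq, fun h' => h1 (mem_of_le (shift_mem_insertPoint T e h') ?_ ?_),
    fun h' => h2 (mem_of_le (shift_mem_insertPoint T e h') ?_ ?_)⟩
  all_goals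
    cases e
    all_goals
      simp only [shift]
      try split_ifs
      all_goals omega

theorem index_right_of_isCorner {μ : YoungDiagram} {r c : ℕ} (h : IsCorner μ (r, c)) :
    (Edge.right r).index μ = (Edge.below c).index μ + 1 := by
  obtain ⟨h1, h2, h3⟩ := h
  simp only [Edge.index, colLen_eq_of_notMem h1 h2, rowLen_eq_of_notMem h1 h3]
  omega

theorem Edge.index_right_le_right {μ : YoungDiagram} {r r' : ℕ} (hr : r' < μ.colLen 0)
    (h : r ≤ r') : (Edge.right r').index μ ≤ (Edge.right r).index μ := by
  rcases h.eq_or_lt with rfl | h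
  · exact le_rfl
  · exact (Edge.index_right_lt_right hr h).le

/-- An insertion at the bottom or right edge of the corner puts the new line against it. An
insertion further Southwest starts a ribbon that runs under the corner; here it matters that the
corner is occupied, since then the special point is not to its left. -/
theorem not_isCorner_shift {r c : ℕ} (hT : T.IsTreeLike) (he : e.IsBorder T.shape)
    (hq : T.IsOccupiedCorner (r, c))
    (hle : e.index T.shape ≤ (Edge.below c).index T.shape + 1) :
    ¬ IsCorner (TreeLike.insertPoint T e).shape (shift T.shape e (r, c)) := by
  have hF := hT.plainInsert he
  have hsF := hF.isBottom_specialPoint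
  obtain ⟨hq0, hc⟩ := hq
  rw [← index_right_of_isCorner hc] at hle
  obtain ⟨hq1, hq2, hq3⟩ := id hc
  have hcol := colLen_eq_of_notMem hq1 hq2
  have hrow := rowLen_eq_of_notMem hq1 hq3
  have hr : r < T.shape.colLen 0 := by
    rw [← mem_iff_col]
    exact mem_of_le hq1 le_rfl (Nat.zero_le _)
  -- The ribbon fills the cell under any bottom point Northeast of the new cell.
  have hbox : ∀ x y, (T.plainInsert e).IsBottom (x, y) → x + 1 ≤ (newCell T.shape e).1 →
      (newCell T.shape e).2 < y → (x + 1, y) ∈ (TreeLike.insertPoint T e).shape := by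
    intro x y hb h1 h2
    have hle := hb.le_specialPoint
    rw [mem_insertPoint hT he]
    refine Or.inr ⟨⟨?_, h1⟩, ⟨h2, hle⟩, mem_of_le (mem_shape hb.1) le_rfl (Nat.sub_le _ _)⟩
    by_contra! hlt
    exact hb.2 (mem_of_le (mem_shape hsF.1) hlt hle)
  rintro ⟨-, h1, h2⟩
  cases e with
  | below c₀ =>
    rcases lt_trichotomy c₀ c with h | h | h
    · have := colLen_le_of_le (μ := T.shape) h.le
      rw [shift, if_pos (by dsimp only; omega)] at h1
      exact h1 (hbox r c ((isBottom_plainInsert_below h).2 ⟨hq0, hq2⟩)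
        (by simp only [newCell]; omega) h)
    · subst h
      rw [shift, if_pos (by dsimp only; omega), mem_insertPoint hT he, mem_insertLine_below] at h1
      exact h1 (Or.inl (Or.inr (Or.inr ⟨hcol.symm, le_rfl⟩)))
    · have := Edge.index_right_lt_below (μ := T.shape) hr (c := c₀) (by omega)
      omega
  | right r₀ =>
    rcases lt_trichotomy r₀ r with h | h | h
    · have := Edge.index_right_lt_right (μ := T.shape) hr h
      omega
    · subst h
      rw [shift, if_pos (by dsimp only; omega), mem_insertPoint hT he, mem_insertLine_right] at h2
      exact h2 (Or.inl (Or.inr (Or.inr ⟨hrow.symm, le_rfl⟩)))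
    · have hw : T.shape.rowLen r₀ ≤ c := by
        by_contra! hlt
        rw [← mem_iff_row] at hlt
        exact hq2 (mem_of_le hlt h le_rfl)
      rw [shift, if_neg (by dsimp only; omega)] at h1
      exact h1 (hbox r (c + 1) ((isBottom_plainInsert_right hw).2 ⟨hq0, hq2⟩)
        (by simp only [newCell]; omega) (by simp only [newCell]; omega))

/-- The new line and the ribbon leave the border Southwest of the insertion as it was, up to a shift
by the inserted row. -/
theorem isCorner_shift {r c : ℕ} (hT : T.IsTreeLike) (he : e.IsBorder T.shape)
    (hc : IsCorner T.shape (r, c))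
    (hlt : (Edge.below c).index T.shape + 1 < e.index T.shape) :
    IsCorner (TreeLike.insertPoint T e).shape (shift T.shape e (r, c)) ∧
      (Edge.below (shift T.shape e (r, c)).2).index (TreeLike.insertPoint T e).shape =
        (Edge.below c).index T.shape := by
  have hmem := shift_mem_insertPoint T e hc.1
  have hidx := index_right_of_isCorner hc
  obtain ⟨hq1, hq2, hq3⟩ := id hc
  have hcol := colLen_eq_of_notMem hq1 hq2
  cases e with
  | below c₀ =>
    have h : c < c₀ := by
      by_contra! h
      have := (Edge.index_below_le_below (μ := T.shape)).2 h
      omega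
    have hh : T.shape.colLen c₀ ≤ r := by
      by_contra! h'
      rw [← mem_iff_col] at h'
      exact hq3 (mem_of_le h' le_rfl h)
    have hsh : shift T.shape (.below c₀) (r, c) = (r + 1, c) := by
      rw [shift, if_neg (by dsimp only; omega)]
    rw [hsh] at hmem ⊢
    have hcor : IsCorner (TreeLike.insertPoint T (.below c₀)).shape (r + 1, c) := by
      refine ⟨hmem, ?_, ?_⟩
      · rw [mem_insertPoint hT he, mem_insertLine_below]
        rintro ((h' | h' | h') | h')
        · omega
        · exact hq2 h'.2
        · omega
        · simp only [newCell] at h'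
          omega
      · rw [mem_insertPoint hT he, mem_insertLine_below]
        rintro ((h' | h' | h') | h')
        · omega
        · exact hq3 h'.2
        · omega
        · simp only [newCell] at h'
          omega
    refine ⟨hcor, ?_⟩
    simp only [Edge.index]
    rw [colLen_zero_insertPoint_below hT he, colLen_eq_of_notMem hcor.1 hcor.2.1, hcol]
    omega
  | right r₀ =>
    have h : r₀ < r := by
      by_contra! h
      have := Edge.index_right_le_right (μ := T.shape) he h
      omega
    have hw : c < T.shape.rowLen r₀ := by
      rw [← mem_iff_row]
      exact mem_of_le hq1 h.le le_rfl
    have hsh : shift T.shape (.right r₀) (r, c) = (r, c) := by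
      rw [shift, if_pos (by dsimp only; omega)]
    rw [hsh] at hmem ⊢
    have hcor : IsCorner (TreeLike.insertPoint T (.right r₀)).shape (r, c) := by
      refine ⟨hmem, ?_, ?_⟩
      · rw [mem_insertPoint hT he, mem_insertLine_right]
        rintro ((h' | h' | h') | h')
        · exact hq2 h'.2
        · omega
        · omega
        · simp only [newCell] at h'
          omega
      · rw [mem_insertPoint hT he, mem_insertLine_right]
        rintro ((h' | h' | h') | h')
        · exact hq3 h'.2
        · omega
        · omega
        · simp only [newCell] at h'
          omega
    refine ⟨hcor, ?_⟩
    simp only [Edge.index]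
    rw [colLen_zero_insertPoint_right hT he, colLen_eq_of_notMem hcor.1 hcor.2.1, hcol]

/-- A point stays in a corner, with the same index, exactly if the insertion takes place to the
Northeast of the corner. -/
theorem isCorner_shift_iff {q : ℕ × ℕ} {i : ℕ} (hT : T.IsTreeLike) (he : e.IsBorder T.shape)
    (hq : q ∈ T.points) :
    (IsCorner (TreeLike.insertPoint T e).shape (shift T.shape e q) ∧
      (Edge.below (shift T.shape e q).2).index (TreeLike.insertPoint T e).shape = i) ↔
    (IsCorner T.shape q ∧ (Edge.below q.2).index T.shape = i) ∧ i + 1 < e.index T.shape := by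
  constructor
  · rintro ⟨h1, rfl⟩
    have hc := isCorner_of_isCorner_shift (mem_shape hq) h1
    have hlt : (Edge.below q.2).index T.shape + 1 < e.index T.shape := by
      by_contra! hle
      exact not_isCorner_shift hT he ⟨hq, hc⟩ hle h1
    have h2 := (isCorner_shift hT he hc hlt).2
    exact ⟨⟨hc, h2.symm⟩, h2 ▸ hlt⟩
  · rintro ⟨⟨hc, rfl⟩, hlt⟩
    exact isCorner_shift hT he hc hlt

end Filling

/-! ### The numbering of the border edges. -/

/-- The edges as a disjoint union of two copies of the natural numbers. -/
def Edge.ofSum : ℕ ⊕ ℕ ↪ Edge where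
  toFun := Sum.elim Edge.below Edge.right
  inj' := by
    rintro (a | a) (b | b) h <;> simp_all

/-- The border edges of a diagram. -/
def borderEdges (μ : YoungDiagram) : Finset Edge :=
  ((Finset.range (μ.rowLen 0)).disjSum (Finset.range (μ.colLen 0))).map Edge.ofSum

theorem Edge.ofSum_inl (c : ℕ) : Edge.ofSum (.inl c) = .below c := rfl

theorem Edge.ofSum_inr (r : ℕ) : Edge.ofSum (.inr r) = .right r := rfl

theorem mem_borderEdges {μ : YoungDiagram} {e : Edge} : e ∈ borderEdges μ ↔ e.IsBorder μ := by
  cases e <;> simp [borderEdges, Edge.ofSum_inl, Edge.ofSum_inr, Edge.IsBorder]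

theorem card_borderEdges (μ : YoungDiagram) :
    (borderEdges μ).card = μ.colLen 0 + μ.rowLen 0 := by
  rw [borderEdges, Finset.card_map, Finset.card_disjSum, Finset.card_range, Finset.card_range,
    add_comm]

theorem Edge.index_mem_Icc {μ : YoungDiagram} {e : Edge} (he : e.IsBorder μ) :
    e.index μ ∈ Finset.Icc 1 (μ.colLen 0 + μ.rowLen 0) := by
  rw [Finset.mem_Icc]
  cases e with
  | below c =>
    simp only [Edge.IsBorder] at he
    simp only [Edge.index]
    omega
  | right r =>
    simp only [Edge.IsBorder] at he
    have := μ.rowLen_anti _ _ (Nat.zero_le r)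
    simp only [Edge.index]
    omega

theorem Edge.index_injOn (μ : YoungDiagram) :
    Set.InjOn (Edge.index μ) (borderEdges μ : Set Edge) := by
  intro e he e' he' h
  rw [Finset.mem_coe, mem_borderEdges] at he he'
  cases e with
  | below c =>
    cases e' with
    | below c' =>
      exact congrArg _ (le_antisymm (Edge.index_below_le_below.1 h.le)
        (Edge.index_below_le_below.1 h.ge))
    | right r =>
      rcases lt_or_ge c (μ.rowLen r) with hlt | hge
      · exact absurd h (Edge.index_below_lt_right he' hlt).ne
      · exact absurd h (Edge.index_right_lt_below he' hge).ne'
  | right r =>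
    cases e' with
    | below c =>
      rcases lt_or_ge c (μ.rowLen r) with hlt | hge
      · exact absurd h (Edge.index_below_lt_right he hlt).ne'
      · exact absurd h (Edge.index_right_lt_below he hge).ne
    | right r' =>
      rcases lt_trichotomy r r' with hlt | rfl | hlt
      · exact absurd h (Edge.index_right_lt_right he' hlt).ne'
      · rfl
      · exact absurd h (Edge.index_right_lt_right he hlt).ne

/-- An injection into an interval with as many elements as there are border edges is onto. -/
theorem image_index_borderEdges (μ : YoungDiagram) :
    (borderEdges μ).image (Edge.index μ) = Finset.Icc 1 (μ.colLen 0 + μ.rowLen 0) := by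
  refine Finset.eq_of_subset_of_card_le (fun j hj => ?_) ?_
  · obtain ⟨e, he, rfl⟩ := Finset.mem_image.1 hj
    exact Edge.index_mem_Icc (mem_borderEdges.1 he)
  · rw [Finset.card_image_of_injOn (Edge.index_injOn μ), card_borderEdges]
    simp

theorem exists_edge_index_eq {μ : YoungDiagram} {j : ℕ}
    (hj : j ∈ Finset.Icc 1 (μ.colLen 0 + μ.rowLen 0)) :
    ∃ e : Edge, e.IsBorder μ ∧ e.index μ = j := by
  rw [← image_index_borderEdges] at hj
  obtain ⟨e, he, h⟩ := Finset.mem_image.1 hj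
  exact ⟨e, mem_borderEdges.1 he, h⟩

end TreeLike

/-! ### Insertion sequences and the number of tableaux. -/

namespace TreeLike

open Filling

theorem stage_succ (E : ℕ → Edge) {n : ℕ} (hn : 1 ≤ n) :
    stage E (n + 1) = insertPoint (stage E n) (E (n + 1)) := by
  obtain ⟨n, rfl⟩ : ∃ m, n = m + 1 := ⟨n - 1, by omega⟩
  rfl

theorem pointCell_succ_self (E : ℕ → Edge) {n : ℕ} (hn : 1 ≤ n) :
    pointCell E (n + 1) (n + 1) = newCell (stage E n).shape (E (n + 1)) := by
  obtain ⟨n, rfl⟩ : ∃ m, n = m + 1 := ⟨n - 1, by omega⟩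
  rw [pointCell, if_pos rfl]

theorem pointCell_succ (E : ℕ → Edge) {n k : ℕ} (hn : 1 ≤ n) (hk : k ≤ n) :
    pointCell E k (n + 1) = shift (stage E n).shape (E (n + 1)) (pointCell E k n) := by
  obtain ⟨n, rfl⟩ : ∃ m, n = m + 1 := ⟨n - 1, by omega⟩
  rw [pointCell, if_neg (by omega)]

/-- Only the values at 2, ..., n matter; the others are arbitrary, so uniqueness of sequences is
asserted only there. -/
theorem stage_congr {E E' : ℕ → Edge} {n : ℕ} (hn : 1 ≤ n)
    (h : ∀ j, 2 ≤ j → j ≤ n → E j = E' j) : stage E n = stage E' n := by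
  induction n, hn using Nat.le_induction with
  | base => rfl
  | succ n hn ih =>
    rw [stage_succ E hn, stage_succ E' hn, ih fun j h1 h2 => h j h1 (by omega),
      h (n + 1) (by omega) le_rfl]

theorem pointCell_congr {E E' : ℕ → Edge} {k n : ℕ} (hn : 1 ≤ n) (hk : k ≤ n)
    (h : ∀ j, 2 ≤ j → j ≤ n → E j = E' j) : pointCell E k n = pointCell E' k n := by
  induction n, hn using Nat.le_induction with
  | base => rfl
  | succ n hn ih =>
    have h' : ∀ j, 2 ≤ j → j ≤ n → E j = E' j := fun j h1 h2 => h j h1 (by omega)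
    rcases Nat.le_succ_iff.1 hk with hk | rfl
    · rw [pointCell_succ E hn hk, pointCell_succ E' hn hk, ih hk h', stage_congr hn h',
        h (n + 1) (by omega) le_rfl]
    · rw [pointCell_succ_self E hn, pointCell_succ_self E' hn, stage_congr hn h',
        h (n + 1) (by omega) le_rfl]

theorem isInsertionSequence_succ {n : ℕ} (hn : 1 ≤ n) {E : ℕ → Edge} {T : Filling} :
    IsInsertionSequence (n + 1) E T ↔ IsInsertionSequence n E (stage E n) ∧
      (E (n + 1)).IsBorder (stage E n).shape ∧ insertPoint (stage E n) (E (n + 1)) = T := by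
  rw [← stage_succ E hn]
  constructor
  · rintro ⟨h1, h2⟩
    exact ⟨⟨fun k hk hk' => h1 k hk (by omega), rfl⟩, h1 (n + 1) (by omega) le_rfl, h2⟩
  · rintro ⟨⟨h1, -⟩, h2, h3⟩
    refine ⟨fun k hk hk' => ?_, h3⟩
    rcases Nat.le_succ_iff.1 hk' with hk' | rfl
    · exact h1 k hk hk'
    · exact h2

theorem IsInsertionSequence.congr {n : ℕ} (hn : 1 ≤ n) {E E' : ℕ → Edge} {T : Filling}
    (hE : IsInsertionSequence n E T) (h : ∀ j, 2 ≤ j → j ≤ n → E j = E' j) :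
    IsInsertionSequence n E' T := by
  refine ⟨fun k hk hk' => ?_, by rw [← stage_congr hn h, hE.2]⟩
  rw [← h k hk hk', ← stage_congr (by omega) fun j h1 h2 => h j h1 (by omega)]
  exact hE.1 k hk hk'

/-- An insertion sequence can be prolonged by any border edge. -/
theorem IsInsertionSequence.update {n : ℕ} (hn : 1 ≤ n) {E : ℕ → Edge} {T : Filling}
    (hE : IsInsertionSequence n E T) {e : Edge} (he : e.IsBorder T.shape) :
    ∃ E' : ℕ → Edge, (∀ j, 2 ≤ j → j ≤ n → E j = E' j) ∧ E' (n + 1) = e ∧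
      IsInsertionSequence (n + 1) E' (insertPoint T e) := by
  have h : ∀ j, 2 ≤ j → j ≤ n → E j = Function.update E (n + 1) e j := fun j _ h2 =>
    (Function.update_of_ne (by omega) _ _).symm
  have hE' := hE.congr hn h
  refine ⟨_, h, Function.update_self _ _ _, (isInsertionSequence_succ hn).2 ?_⟩
  rw [hE'.2, Function.update_self]
  exact ⟨hE', he, rfl⟩

theorem mem_single_shape {x y : ℕ} : (x, y) ∈ single.shape ↔ x = 0 ∧ y = 0 := by
  rw [← YoungDiagram.mem_cells]
  simp [single]

theorem single_isTreeLike : single.IsTreeLike := by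
  refine isTreeLike_iff.2 ⟨?_, ?_, ?_, ?_⟩
  · simp [single]
  · intro x y h h'
    simp only [single, Finset.mem_singleton] at h
    exact absurd h h'
  · intro x h
    rw [mem_single_shape] at h
    exact ⟨0, by simp [single, h.1]⟩
  · intro y h
    rw [mem_single_shape] at h
    exact ⟨0, by simp [single, h.2]⟩

theorem tableaux_one : tableaux 1 = {single} := by
  ext T
  rw [Set.mem_singleton_iff]
  constructor
  · rintro ⟨hT, hc⟩
    have hpts : T.points = {(0, 0)} := by
      obtain ⟨a, ha⟩ := Finset.card_eq_one.1 hc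
      have := hT.root
      rw [ha, Finset.mem_singleton] at this
      rw [ha, this]
    have h := isTreeLike_iff.1 hT
    rw [hpts] at h
    simp only [Finset.mem_singleton, Prod.mk.injEq] at h
    refine ext_mem (fun x y => ?_) fun x y => by rw [hpts]; rfl
    rw [mem_single_shape]
    constructor
    · intro hxy
      obtain ⟨_, h1, -⟩ := h.2.2.1 x (mem_of_le hxy le_rfl (Nat.zero_le _))
      obtain ⟨_, -, h2⟩ := h.2.2.2 y (mem_of_le hxy (Nat.zero_le _) le_rfl)
      exact ⟨h1, h2⟩
    · rintro ⟨rfl, rfl⟩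
      exact mem_shape hT.root
  · rintro rfl
    exact ⟨single_isTreeLike, rfl⟩

theorem insertPoint_mem_tableaux {n : ℕ} {T : Filling} {e : Edge} (hT : T ∈ tableaux n)
    (he : e.IsBorder T.shape) : insertPoint T e ∈ tableaux (n + 1) :=
  ⟨hT.1.insertPoint he, by rw [card_insertPoint, hT.2]⟩

theorem exists_insertPoint_of_mem_tableaux {n : ℕ} (hn : 1 ≤ n) {T : Filling}
    (hT : T ∈ tableaux (n + 1)) :
    ∃ T' ∈ tableaux n, ∃ e, e.IsBorder T'.shape ∧ insertPoint T' e = T := by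
  obtain ⟨T', e, h1, h2, rfl⟩ := exists_insertPoint_eq hT.1 (by rw [hT.2]; omega)
  refine ⟨T', ⟨h1, ?_⟩, e, h2, rfl⟩
  have := hT.2
  rw [card_insertPoint] at this
  omega

theorem IsInsertionSequence.mem_tableaux {n : ℕ} (hn : 1 ≤ n) {E : ℕ → Edge} {T : Filling}
    (h : IsInsertionSequence n E T) : T ∈ tableaux n := by
  induction n, hn using Nat.le_induction generalizing T with
  | base =>
    rw [tableaux_one]
    exact h.2.symm
  | succ n hn ih =>
    obtain ⟨h1, h2, rfl⟩ := (isInsertionSequence_succ hn).1 h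
    exact insertPoint_mem_tableaux (ih h1) h2

theorem exists_isInsertionSequence {n : ℕ} (hn : 1 ≤ n) {T : Filling} (hT : T ∈ tableaux n) :
    ∃ E, IsInsertionSequence n E T := by
  induction n, hn using Nat.le_induction generalizing T with
  | base =>
    rw [tableaux_one] at hT
    exact ⟨fun _ => .below 0, fun k h1 h2 => by omega, hT.symm⟩
  | succ n hn ih =>
    obtain ⟨T', hT', e, he, rfl⟩ := exists_insertPoint_of_mem_tableaux hn hT
    obtain ⟨E, hE⟩ := ih hT'
    obtain ⟨E', -, -, h⟩ := hE.update hn he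
    exact ⟨E', h⟩

theorem IsInsertionSequence.unique {n : ℕ} (hn : 1 ≤ n) {E E' : ℕ → Edge} {T : Filling}
    (hE : IsInsertionSequence n E T) (hE' : IsInsertionSequence n E' T) :
    ∀ k, 2 ≤ k → k ≤ n → E k = E' k := by
  induction n, hn using Nat.le_induction generalizing T with
  | base => intro k h1 h2; omega
  | succ n hn ih =>
    obtain ⟨h1, h2, h3⟩ := (isInsertionSequence_succ hn).1 hE
    obtain ⟨h1', h2', h3'⟩ := (isInsertionSequence_succ hn).1 hE'
    obtain ⟨h4, h5⟩ := insertPoint_injective (h1.mem_tableaux hn).1 h2 (h1'.mem_tableaux hn).1 h2'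
      (h3.trans h3'.symm)
    rw [← h4] at h1'
    intro k hk hk'
    rcases Nat.le_succ_iff.1 hk' with hk' | rfl
    · exact ih h1 h1' k hk hk'
    · exact h5

theorem points_eq_image_pointCell {n : ℕ} (hn : 1 ≤ n) (E : ℕ → Edge) :
    (stage E n).points = (Finset.Icc 1 n).image fun k => pointCell E k n := by
  induction n, hn using Nat.le_induction with
  | base => rfl
  | succ n hn ih =>
    rw [stage_succ E hn, ← Finset.insert_Icc_right_eq_Icc_add_one (by omega), Finset.image_insert,
      pointCell_succ_self E hn]
    change insert _ (Finset.image _ _) = _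
    rw [ih, Finset.image_image]
    refine congrArg _ (Finset.image_congr fun k hk => ?_)
    rw [Finset.mem_coe, Finset.mem_Icc] at hk
    exact (pointCell_succ E hn hk.2).symm

theorem IsInsertionSequence.pointCell_mem {n k : ℕ} {E : ℕ → Edge} {T : Filling}
    (hE : IsInsertionSequence n E T) (hk : 1 ≤ k) (hkn : k ≤ n) : pointCell E k n ∈ T.points := by
  rw [← hE.2, points_eq_image_pointCell (hk.trans hkn)]
  exact Finset.mem_image_of_mem _ (Finset.mem_Icc.2 ⟨hk, hkn⟩)

theorem semiperimeter_eq {n : ℕ} (hn : 1 ≤ n) {T : Filling} (hT : T ∈ tableaux n) :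
    T.shape.colLen 0 + T.shape.rowLen 0 = n + 1 := by
  induction n, hn using Nat.le_induction generalizing T with
  | base =>
    rw [tableaux_one, Set.mem_singleton_iff] at hT
    subst hT
    have h1 : single.shape.colLen 0 = 1 := colLen_eq_iff.2 fun x => by
      rw [mem_single_shape]; omega
    have h2 : single.shape.rowLen 0 = 1 := rowLen_eq_iff.2 fun x => by
      rw [mem_single_shape]; omega
    rw [h1, h2]
  | succ n hn ih =>
    obtain ⟨T', hT', e, he, rfl⟩ := exists_insertPoint_of_mem_tableaux hn hT
    rw [semiperimeter_insertPoint hT'.1 he, ih hT']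

/-- The tableaux obtained from those in `X` by insertions at edges with index in `J`. -/
def insertions (X : Set Filling) (J : Finset ℕ) : Set Filling :=
  {T' | ∃ T ∈ X, ∃ e : Edge, e.IsBorder T.shape ∧ e.index T.shape ∈ J ∧ insertPoint T e = T'}

/-- Tableau and edge are determined by the result, and each index is carried by exactly one border
edge. -/
theorem ncard_insertions {n : ℕ} (hn : 1 ≤ n) {X : Set Filling} (hX : X ⊆ tableaux n)
    {J : Finset ℕ} (hJ : J ⊆ Finset.Icc 1 (n + 1)) :
    (insertions X J).ncard = X.ncard * J.card := by
  have hex : ∀ T ∈ X, ∀ j ∈ J, ∃ e : Edge, e.IsBorder T.shape ∧ e.index T.shape = j := by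
    intro T hT j hj
    refine exists_edge_index_eq ?_
    rw [semiperimeter_eq hn (hX hT)]
    exact hJ hj
  have : Nonempty Edge := ⟨.below 0⟩
  choose! f hf1 hf2 using hex
  have himg : insertions X J = (fun q : Filling × ℕ => insertPoint q.1 (f q.1 q.2)) ''
      (X ×ˢ (J : Set ℕ)) := by
    ext T'
    constructor
    · rintro ⟨T, hT, e, he, hj, rfl⟩
      refine ⟨(T, e.index T.shape), ⟨hT, hj⟩, ?_⟩
      dsimp only
      rw [Edge.index_injOn T.shape (mem_borderEdges.2 (hf1 T hT _ hj)) (mem_borderEdges.2 he)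
        (hf2 T hT _ hj)]
    · rintro ⟨⟨T, j⟩, ⟨hT, hj⟩, rfl⟩
      exact ⟨T, hT, _, hf1 T hT j hj, (hf2 T hT j hj).symm ▸ hj, rfl⟩
  rw [himg, Set.InjOn.ncard_image, Set.ncard_prod, Set.ncard_coe_finset]
  rintro ⟨T, j⟩ ⟨hT, hj⟩ ⟨T', j'⟩ ⟨hT', hj'⟩ h
  obtain ⟨h1, h2⟩ := insertPoint_injective (hX hT).1 (hf1 T hT j hj) (hX hT').1
    (hf1 T' hT' j' hj') h
  dsimp only at hT hj hT' hj' h1 h2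
  subst h1
  rw [Prod.mk.injEq]
  refine ⟨rfl, ?_⟩
  rw [← hf2 T hT j hj, h2, hf2 T hT j' hj']

theorem tableaux_succ {n : ℕ} (hn : 1 ≤ n) :
    tableaux (n + 1) = insertions (tableaux n) (Finset.Icc 1 (n + 1)) := by
  ext T
  constructor
  · intro hT
    obtain ⟨T', hT', e, he, rfl⟩ := exists_insertPoint_of_mem_tableaux hn hT
    refine ⟨T', hT', e, he, ?_, rfl⟩
    rw [← semiperimeter_eq hn hT']
    exact Edge.index_mem_Icc he
  · rintro ⟨T', hT', e, he, -, rfl⟩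
    exact insertPoint_mem_tableaux hT' he

theorem ncard_tableaux {n : ℕ} (hn : 1 ≤ n) : (tableaux n).ncard = n.factorial := by
  induction n, hn using Nat.le_induction with
  | base => rw [tableaux_one, Set.ncard_singleton, Nat.factorial_one]
  | succ n hn ih =>
    rw [tableaux_succ hn, ncard_insertions hn subset_rfl subset_rfl, ih, Nat.factorial_succ]
    simp [mul_comm]

theorem finite_tableaux {n : ℕ} (hn : 1 ≤ n) : (tableaux n).Finite :=
  Set.finite_of_ncard_ne_zero (by rw [ncard_tableaux hn]; exact Nat.factorial_ne_zero _)

theorem sp_single : sp single = 1 := by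
  have h : specialPoint single = (0, 0) := by
    refine specialPoint_eq ⟨single_isTreeLike.root, ?_⟩ fun q hq => ?_
    · rw [mem_single_shape]
      omega
    · have : q = (0, 0) := Finset.mem_singleton.1 hq.1
      rw [this]
  rw [sp, ← specialPoint_snd, h]
  simp [Edge.index]

/-- For size at least 2, `sp` is the index of the last insertion, so it is uniformly distributed on
1, ..., n. Size 1 is checked directly. -/
theorem ncard_sp_le {n : ℕ} (hn : 1 ≤ n) {i : ℕ} (hi : 1 ≤ i) :
    {T ∈ tableaux n | sp T ≤ i}.ncard = (n - 1).factorial * min i n := by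
  rcases hn.eq_or_lt with rfl | hn
  · have : {T ∈ tableaux 1 | sp T ≤ i} = {single} := by
      ext T
      rw [tableaux_one]
      simp only [Set.mem_singleton_iff, Set.mem_ofPred_eq]
      refine and_iff_left_of_imp ?_
      rintro rfl
      rwa [sp_single]
    rw [this, Set.ncard_singleton]
    simp [hi]
  · obtain ⟨n, rfl⟩ : ∃ m, n = m + 1 := ⟨n - 1, by omega⟩
    have hn : 1 ≤ n := by omega
    have : {T ∈ tableaux (n + 1) | sp T ≤ i} =
        insertions (tableaux n) (Finset.Icc 1 (min i (n + 1))) := by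
      ext T
      rw [tableaux_succ hn]
      constructor
      · rintro ⟨⟨T', hT', e, he, hj, rfl⟩, hsp⟩
        rw [sp_insertPoint hT'.1 he] at hsp
        rw [Finset.mem_Icc] at hj
        exact ⟨T', hT', e, he, by rw [Finset.mem_Icc]; omega, rfl⟩
      · rintro ⟨T', hT', e, he, hj, rfl⟩
        rw [Finset.mem_Icc] at hj
        refine ⟨⟨T', hT', e, he, by rw [Finset.mem_Icc]; omega, rfl⟩, ?_⟩
        rw [sp_insertPoint hT'.1 he]
        omega
    rw [this, ncard_insertions hn subset_rfl (Finset.Icc_subset_Icc le_rfl (min_le_right _ _)),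
      ncard_tableaux hn]
    simp

/-! ### Tableaux with p_k in a corner of given index. -/

/-- The tableaux of size `n` whose `k`-th point lies in a corner, the edge under it having
index `i`. -/
def cornerSet (n k i : ℕ) : Set Filling :=
  {T | ∃ E : ℕ → Edge, IsInsertionSequence n E T ∧ IsCorner T.shape (pointCell E k n) ∧
    (Edge.below (pointCell E k n).2).index T.shape = i}

theorem cornerSet_subset {n : ℕ} (hn : 1 ≤ n) (k i : ℕ) : cornerSet n k i ⊆ tableaux n := by
  rintro T ⟨E, hE, -⟩
  exact hE.mem_tableaux hn

theorem cornerSet_succ_self {n : ℕ} (hn : 1 ≤ n) (i : ℕ) :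
    cornerSet (n + 1) (n + 1) i = insertions {T ∈ tableaux n | sp T ≤ i} {i} := by
  ext T
  constructor
  · rintro ⟨E, hE, h1, h2⟩
    obtain ⟨h3, h4, rfl⟩ := (isInsertionSequence_succ hn).1 hE
    have hT := h3.mem_tableaux hn
    rw [pointCell_succ_self E hn] at h1 h2
    rw [index_newCell hT.1 h4] at h2
    rw [isCorner_newCell_iff hT.1 h4, h2] at h1
    exact ⟨_, ⟨hT, h1⟩, _, h4, Finset.mem_singleton.2 h2, rfl⟩
  · rintro ⟨T, ⟨hT, hsp⟩, e, he, hi, rfl⟩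
    rw [Finset.mem_singleton] at hi
    subst hi
    obtain ⟨E, hE⟩ := exists_isInsertionSequence hn hT
    obtain ⟨E', h1, h2, h3⟩ := hE.update hn he
    have hs : stage E' n = T := by rw [← stage_congr hn h1, hE.2]
    refine ⟨E', h3, ?_⟩
    rw [pointCell_succ_self E' hn, hs, h2]
    exact ⟨(isCorner_newCell_iff hT.1 he).2 hsp, index_newCell hT.1 he⟩

theorem cornerSet_succ {n k : ℕ} (hk : 1 ≤ k) (hkn : k ≤ n) (i : ℕ) :
    cornerSet (n + 1) k i = insertions (cornerSet n k i) (Finset.Icc (i + 2) (n + 1)) := by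
  have hn : 1 ≤ n := hk.trans hkn
  ext T
  constructor
  · rintro ⟨E, hE, h1, h2⟩
    obtain ⟨h3, h4, rfl⟩ := (isInsertionSequence_succ hn).1 hE
    have hT := h3.mem_tableaux hn
    rw [pointCell_succ E hn hkn] at h1 h2
    obtain ⟨⟨h5, h6⟩, h7⟩ := (isCorner_shift_iff hT.1 h4 (h3.pointCell_mem hk hkn)).1 ⟨h1, h2⟩
    refine ⟨_, ⟨E, h3, h5, h6⟩, _, h4, ?_, rfl⟩
    have := Edge.index_mem_Icc h4
    rw [semiperimeter_eq hn hT, Finset.mem_Icc] at this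
    rw [Finset.mem_Icc]
    omega
  · rintro ⟨T, ⟨E, hE, h1, h2⟩, e, he, hi, rfl⟩
    rw [Finset.mem_Icc] at hi
    obtain ⟨E', h3, h4, h5⟩ := hE.update hn he
    have hs : stage E' n = T := by rw [← stage_congr hn h3, hE.2]
    refine ⟨E', h5, ?_⟩
    rw [pointCell_succ E' hn hkn, hs, h4, ← pointCell_congr hn hkn h3]
    exact (isCorner_shift_iff (hE.mem_tableaux hn).1 he (hE.pointCell_mem hk hkn)).2
      ⟨⟨h1, h2⟩, hi.1⟩

/-- The first two factors count the tableaux of size k - 1 with `sp` at most i; each later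
insertion, from size m to m + 1, has the m - i indices i + 2, ..., m + 1 at its disposal. -/
theorem ncard_cornerSet {k : ℕ} (hk : 2 ≤ k) (d : ℕ) {i : ℕ} (hi : i ∈ Finset.Icc 1 k) :
    (cornerSet (k + d) k i).ncard =
      (k - 2).factorial * min i (k - 1) * (k - i).ascFactorial d := by
  obtain ⟨n, rfl⟩ : ∃ n, k = n + 1 := ⟨k - 1, by omega⟩
  have hi' := Finset.mem_Icc.1 hi
  induction d with
  | zero =>
    rw [Nat.add_zero, cornerSet_succ_self (by omega), ncard_insertions (n := n) (by omega)
      (fun T hT => hT.1) (Finset.singleton_subset_iff.2 hi), ncard_sp_le (by omega) hi'.1,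
      Finset.card_singleton, Nat.ascFactorial_zero]
    rfl
  | succ d ih =>
    rw [← Nat.add_assoc, cornerSet_succ (by omega) (by omega), ncard_insertions (by omega)
      (cornerSet_subset (by omega) _ _) (Finset.Icc_subset_Icc (by omega) le_rfl), ih,
      Nat.ascFactorial_succ, Nat.card_Icc, mul_assoc, mul_assoc, mul_assoc]
    congr 2
    rw [mul_comm]
    congr 1
    omega

theorem index_mem_of_cornerSet_nonempty {k : ℕ} (hk : 2 ≤ k) (d : ℕ) {i : ℕ}
    (h : (cornerSet (k + d) k i).Nonempty) : i ∈ Finset.Icc 1 k := by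
  induction d with
  | zero =>
    obtain ⟨n, rfl⟩ : ∃ n, k = n + 1 := ⟨k - 1, by omega⟩
    rw [Nat.add_zero, cornerSet_succ_self (by omega)] at h
    obtain ⟨_, T, hT, e, he, hi, -⟩ := h
    rw [← Finset.mem_singleton.1 hi, ← semiperimeter_eq (by omega) hT.1]
    exact Edge.index_mem_Icc he
  | succ d ih =>
    rw [← Nat.add_assoc, cornerSet_succ (by omega) (by omega)] at h
    obtain ⟨_, T, hT, -⟩ := h
    exact ih ⟨T, hT⟩

theorem cornerCount_eq_sum {k : ℕ} (hk : 2 ≤ k) (d : ℕ) :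
    cornerCount (k + d) k = ∑ i ∈ Finset.Icc 1 k, (cornerSet (k + d) k i).ncard := by
  classical
  have hn : 1 ≤ k + d := by omega
  have hfin : ∀ i, (cornerSet (k + d) k i).Finite := fun i =>
    (finite_tableaux hn).subset (cornerSet_subset hn k i)
  have hset : {T ∈ tableaux (k + d) | PointInCorner (k + d) k T} =
      ((Finset.Icc 1 k).biUnion fun i => (hfin i).toFinset : Finset Filling) := by
    ext T
    simp only [Finset.coe_biUnion, Set.mem_iUnion, Finset.mem_coe, Set.Finite.mem_toFinset,
      exists_prop]
    constructor
    · rintro ⟨-, E, hE, hc⟩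
      have : T ∈ cornerSet (k + d) k _ := ⟨E, hE, hc, rfl⟩
      exact ⟨_, index_mem_of_cornerSet_nonempty hk d ⟨T, this⟩, this⟩
    · rintro ⟨i, -, E, hE, hc, -⟩
      exact ⟨hE.mem_tableaux hn, E, hE, hc⟩
  rw [cornerCount, hset, Set.ncard_coe_finset, Finset.card_biUnion]
  · exact Finset.sum_congr rfl fun i _ => (Set.ncard_eq_toFinset_card _ (hfin i)).symm
  · intro i _ j _ hij
    refine Finset.disjoint_left.2 fun T hi hj => hij ?_
    rw [Set.Finite.mem_toFinset] at hi hj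
    obtain ⟨E, hE, -, rfl⟩ := hi
    obtain ⟨E', hE', -, rfl⟩ := hj
    -- The index depends on the tableau only, since its insertion sequence is unique.
    rw [pointCell_congr hn (by omega) (hE.unique hn hE')]

end TreeLike

/-! ### Summation. -/

namespace TreeLike

open Filling

/-- Discrete derivative of the rising factorial in its base; the two sums below integrate it once
and twice. -/
theorem ascFactorial_add_succ_mul (K d : ℕ) :
    K.ascFactorial (d + 1) + (d + 1) * (K + 1).ascFactorial d = (K + 1).ascFactorial (d + 1) := by
  have := Nat.succ_ascFactorial K d
  rw [Nat.succ_eq_add_one] at this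
  rw [Nat.ascFactorial_succ, ← this, Nat.ascFactorial_succ]
  ring

theorem sum_ascFactorial (K d : ℕ) :
    (d + 1) * ∑ i ∈ Finset.range K, (K - i).ascFactorial d = K.ascFactorial (d + 1) := by
  induction K with
  | zero => simp [Nat.zero_ascFactorial]
  | succ K ih =>
    rw [Finset.sum_range_succ', Nat.sub_zero, mul_add, ← ascFactorial_add_succ_mul, ← ih]
    simp only [Nat.add_sub_add_right]

theorem sum_succ_mul_ascFactorial (K d : ℕ) :
    (d + 2) * ((d + 1) * ∑ i ∈ Finset.range K, (i + 1) * (K - i).ascFactorial d) =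
      K.ascFactorial (d + 2) := by
  induction K with
  | zero => simp [Nat.zero_ascFactorial]
  | succ K ih =>
    -- Passing from K to K + 1 raises each weight by one, which adds one copy of the unweighted sum.
    have h1 : ∑ i ∈ Finset.range (K + 1), (i + 1) * (K + 1 - i).ascFactorial d =
        ∑ i ∈ Finset.range K, (i + 1) * (K - i).ascFactorial d +
          ∑ i ∈ Finset.range (K + 1), (K + 1 - i).ascFactorial d := by
      rw [Finset.sum_range_succ', Finset.sum_range_succ' (fun i => (K + 1 - i).ascFactorial d),
        ← add_assoc, ← Finset.sum_add_distrib]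
      simp only [Nat.add_sub_add_right]
      congr 1
      · exact Finset.sum_congr rfl fun i _ => by ring
      · simp
    rw [h1, mul_add, mul_add, ih, sum_ascFactorial]
    exact ascFactorial_add_succ_mul K (d + 1)

/-- The formula for k = K + 1 and n = k + d without denominators. The rising factorial of 0 is the
indicator of d = 0; it comes from the index i = k. -/
theorem cornerCount_add (K d : ℕ) (hK : 1 ≤ K) :
    (d + 2) * ((d + 1) * cornerCount (K + 1 + d) (K + 1)) =
      (K + 1 + d).factorial + (d + 2) * ((d + 1) * (K.factorial * (0 : ℕ).ascFactorial d)) := by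
  have h1 : cornerCount (K + 1 + d) (K + 1) = (K - 1).factorial *
      (∑ i ∈ Finset.range K, (i + 1) * (K - i).ascFactorial d + K * (0 : ℕ).ascFactorial d) := by
    rw [cornerCount_eq_sum (by omega),
      Finset.sum_congr rfl fun i hi => ncard_cornerSet (k := K + 1) (by omega) d hi,
      ← Finset.Ico_add_one_right_eq_Icc, Finset.sum_Ico_eq_sum_range, Nat.add_sub_cancel,
      Finset.sum_range_succ, mul_add, Finset.mul_sum]
    congr 1
    · refine Finset.sum_congr rfl fun i hi => ?_
      rw [Finset.mem_range] at hi
      rw [show min (1 + i) (K + 1 - 1) = i + 1 by omega, show K + 1 - (1 + i) = K - i by omega,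
        show K + 1 - 2 = K - 1 by omega, mul_assoc]
    · rw [show min (1 + K) (K + 1 - 1) = K by omega, show K + 1 - (1 + K) = 0 by omega,
        show K + 1 - 2 = K - 1 by omega, mul_assoc]
  obtain ⟨L, rfl⟩ : ∃ L, K = L + 1 := ⟨K - 1, by omega⟩
  have h2 := Nat.factorial_mul_ascFactorial L (d + 2)
  rw [← sum_succ_mul_ascFactorial] at h2
  rw [h1, show L + 1 + 1 + d = L + (d + 2) by omega, ← h2, Nat.factorial_succ, Nat.add_sub_cancel]
  ring

theorem cornerCount_eq {n k : ℕ} (hk : 2 ≤ k) (hkn : k ≤ n) : (cornerCount n k : ℚ) =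
    (n.factorial : ℚ) / (((n : ℚ) - k + 2) * ((n : ℚ) - k + 1)) +
      (if k = n then ((n - 1).factorial : ℚ) else 0) := by
  obtain ⟨d, rfl⟩ := Nat.exists_eq_add_of_le hkn
  obtain ⟨K, rfl⟩ : ∃ K, k = K + 1 := ⟨k - 1, by omega⟩
  have h := congrArg (Nat.cast : ℕ → ℚ) (cornerCount_add K d (by omega))
  push_cast at h
  have h2 : (d : ℚ) + 2 ≠ 0 := by positivity
  have h1 : (d : ℚ) + 1 ≠ 0 := by positivity
  have hd : ((K + 1 + d : ℕ) : ℚ) - (K + 1 : ℕ) = d := by push_cast; ring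
  have hif : (if K + 1 = K + 1 + d then ((K + 1 + d - 1).factorial : ℚ) else 0) =
      K.factorial * (0 : ℕ).ascFactorial d := by
    cases d with
    | zero => simp
    | succ d => simp [Nat.zero_ascFactorial]
  rw [hif, hd, eq_comm, div_add' _ _ _ (mul_ne_zero h2 h1), div_eq_iff (mul_ne_zero h2 h1)]
  linear_combination -h

/-- Each term is 1/(n-k+1) - 1/(n-k+2), so the sum telescopes. -/
theorem sum_one_div_mul (n m : ℕ) (hm : 1 ≤ m) (hmn : m ≤ n) :
    ∑ k ∈ Finset.Icc 2 m, 1 / (((n : ℚ) - k + 2) * ((n : ℚ) - k + 1)) =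
      1 / ((n : ℚ) - m + 1) - 1 / n := by
  induction m, hm using Nat.le_induction with
  | base => simp
  | succ m hm ih =>
    have h0 : (m : ℚ) + 1 ≤ n := by exact_mod_cast hmn
    have h1 : (n : ℚ) - m + 1 ≠ 0 := by linarith
    rw [← Finset.insert_Icc_right_eq_Icc_add_one (by omega), Finset.sum_insert (by simp),
      ih (by omega)]
    push_cast
    have h3 : (n : ℚ) - (m + 1) + 1 ≠ 0 := by linarith
    have h4 : (n : ℚ) - (m + 1) + 2 ≠ 0 := by linarith
    have h5 : (n : ℚ) ≠ 0 := by
      have : (0 : ℚ) ≤ m := Nat.cast_nonneg _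
      linarith
    field_simp
    ring

theorem sum_cornerCount {n : ℕ} (hn : 2 ≤ n) :
    ∑ k ∈ Finset.Icc 2 n, cornerCount n k = n.factorial := by
  have h : ((∑ k ∈ Finset.Icc 2 n, cornerCount n k : ℕ) : ℚ) = (n.factorial : ℚ) := by
    have hn0 : (n : ℚ) ≠ 0 := by
      have : n ≠ 0 := by omega
      exact_mod_cast this
    have hfac : (n.factorial : ℚ) = n * (n - 1).factorial := by
      exact_mod_cast (Nat.mul_factorial_pred (by omega)).symm
    push_cast
    rw [Finset.sum_congr rfl fun k hk =>
      cornerCount_eq (Finset.mem_Icc.1 hk).1 (Finset.mem_Icc.1 hk).2, Finset.sum_add_distrib,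
      Finset.sum_ite_eq' (Finset.Icc 2 n) n, if_pos (Finset.mem_Icc.2 ⟨hn, le_rfl⟩)]
    have := sum_one_div_mul n n (by omega) le_rfl
    simp only [div_eq_mul_one_div (n.factorial : ℚ)]
    rw [← Finset.mul_sum, this, hfac]
    field_simp
    ring
  exact_mod_cast h

theorem pointCell_one {n : ℕ} (hn : 1 ≤ n) {E : ℕ → Edge} {T : Filling}
    (hE : IsInsertionSequence n E T) : pointCell E 1 n = (0, 0) := by
  induction n, hn using Nat.le_induction generalizing T with
  | base => rfl
  | succ n hn ih =>
    obtain ⟨h1, h2, -⟩ := (isInsertionSequence_succ hn).1 hE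
    rw [pointCell_succ E hn hn, ih h1, shift_zero h2]

/-- A corner at the root means a single cell, whose two border edges are fewer than n + 1. -/
theorem not_isCorner_zero {n : ℕ} (hn : 2 ≤ n) {T : Filling} (hT : T ∈ tableaux n) :
    ¬ IsCorner T.shape (0, 0) := by
  rintro ⟨h0, h1, h2⟩
  have h3 := semiperimeter_eq (by omega) hT
  rw [colLen_eq_of_notMem h0 h1, rowLen_eq_of_notMem h0 h2] at h3
  omega

theorem pointInCorner_iff {n k : ℕ} (hn : 1 ≤ n) (hkn : k ≤ n) {E : ℕ → Edge}
    {T : Filling} (hE : IsInsertionSequence n E T) :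
    PointInCorner n k T ↔ IsCorner T.shape (pointCell E k n) := by
  constructor
  · rintro ⟨E', hE', h⟩
    rwa [pointCell_congr hn hkn (hE.unique hn hE')]
  · exact fun h => ⟨E, hE, h⟩

open Classical in
-- The points are p_1, ..., p_n without repetition, and p_1 stays at the root.
theorem oc_eq_card {n : ℕ} (hn : 2 ≤ n) {T : Filling} (hT : T ∈ tableaux n) :
    oc T = ((Finset.Icc 2 n).filter fun k => PointInCorner n k T).card := by
  have hn1 : 1 ≤ n := by omega
  obtain ⟨E, hE⟩ := exists_isInsertionSequence hn1 hT
  have hpts : T.points = (Finset.Icc 1 n).image fun k => pointCell E k n := by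
    rw [← points_eq_image_pointCell hn1, hE.2]
  have hinj : Set.InjOn (fun k => pointCell E k n) (Finset.Icc 1 n : Set ℕ) := by
    rw [← Finset.card_image_iff, ← hpts, hT.2]
    simp
  have hset : T.points.filter (IsCorner T.shape) =
      ((Finset.Icc 2 n).filter fun k => PointInCorner n k T).image fun k => pointCell E k n := by
    ext q
    simp only [hpts, Finset.mem_filter, Finset.mem_image, Finset.mem_Icc]
    constructor
    · rintro ⟨⟨k, ⟨hk1, hk2⟩, rfl⟩, hc⟩
      refine ⟨k, ⟨⟨?_, hk2⟩, (pointInCorner_iff hn1 hk2 hE).2 hc⟩, rfl⟩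
      rcases hk1.eq_or_lt with rfl | h
      · rw [pointCell_one hn1 hE] at hc
        exact absurd hc (not_isCorner_zero hn hT)
      · exact h
    · rintro ⟨k, ⟨⟨hk1, hk2⟩, hc⟩, rfl⟩
      exact ⟨⟨k, ⟨by omega, hk2⟩, rfl⟩, (pointInCorner_iff hn1 hk2 hE).1 hc⟩
  rw [oc, hset, Finset.card_image_of_injOn]
  refine hinj.mono fun k hk => ?_
  simp only [Finset.coe_filter, Finset.mem_Icc, Set.mem_ofPred_eq] at hk
  rw [Finset.mem_coe, Finset.mem_Icc]
  omega

theorem sum_cornerCount_eq_ocSet {n : ℕ} (hn : 2 ≤ n) :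
    ∑ k ∈ Finset.Icc 2 n, cornerCount n k = ocSet (tableaux n) := by
  classical
  have hfin := finite_tableaux (n := n) (by omega)
  rw [ocSet, finsum_mem_eq_finite_toFinset_sum _ hfin,
    Finset.sum_congr rfl fun T hT => oc_eq_card hn (hfin.mem_toFinset.1 hT)]
  simp only [Finset.card_filter]
  -- Double counting of the pairs of a tableau and a point p_k in one of its corners.
  rw [Finset.sum_comm]
  refine Finset.sum_congr rfl fun k _ => ?_
  rw [← Finset.card_filter, cornerCount, ← Set.ncard_coe_finset]
  congr 1
  ext T
  simp

theorem ocSet_tableaux_one : ocSet (tableaux 1) = 1 := by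
  rw [tableaux_one, ocSet, finsum_mem_singleton, oc]
  have : single.points.filter (IsCorner single.shape) = {(0, 0)} := by
    refine Finset.filter_true_of_mem fun q hq => ?_
    rw [show q = (0, 0) from Finset.mem_singleton.1 hq]
    refine ⟨mem_single_shape.2 ⟨rfl, rfl⟩, ?_, ?_⟩
    all_goals
      rw [mem_single_shape]
      omega
  rw [this, Finset.card_singleton]

end TreeLike

theorem mainTheorem4 (n : ℕ) (hn : 1 ≤ n) :
    -- the points `p_k` are well defined: insertion sequences exist and are unique
    (∀ T ∈ TreeLike.tableaux n, ∃ E : ℕ → TreeLike.Edge,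
      TreeLike.IsInsertionSequence n E T ∧
      ∀ E' : ℕ → TreeLike.Edge, TreeLike.IsInsertionSequence n E' T →
        ∀ k, 2 ≤ k → k ≤ n → E' k = E k) ∧
    (∀ k : ℕ, 2 ≤ k → k ≤ n →
      (TreeLike.cornerCount n k : ℚ) =
        (n.factorial : ℚ) / (((n : ℚ) - k + 2) * ((n : ℚ) - k + 1)) +
          (if k = n then ((n - 1).factorial : ℚ) else 0)) ∧
    (2 ≤ n → ∑ k ∈ Finset.Icc 2 n, TreeLike.cornerCount n k =
      TreeLike.ocSet (TreeLike.tableaux n)) ∧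
    TreeLike.ocSet (TreeLike.tableaux n) = n.factorial := by
  refine ⟨fun T hT => ?_, fun k hk hkn => TreeLike.cornerCount_eq hk hkn,
    fun h => TreeLike.sum_cornerCount_eq_ocSet h, ?_⟩
  · obtain ⟨E, hE⟩ := TreeLike.exists_isInsertionSequence hn hT
    exact ⟨E, hE, fun E' hE' => hE'.unique hn hE⟩
  · rcases hn.eq_or_lt with rfl | h
    · exact TreeLike.ocSet_tableaux_one
    · rw [← TreeLike.sum_cornerCount_eq_ocSet h, TreeLike.sum_cornerCount h]
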